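/- Let $n\ge 1$, $m\ge 0$, let $\Xi$ be a set, and let $A:\Xi\to\mathbb R^{n\times n}$ be such that every $A(\xi)$ is positive definite (not necessarily symmetric), i.e. $\langle A(\xi)w,w\rangle>0$ for all $w\ne 0$. Fix $\xi_1,\dots,\xi_m,\xi\in\Xi$ and put $P_i=A(\xi_i)^{-1}$, $\gamma_i^-=\inf_{w\neq0}\langle P_iw,w\rangle/\|w\|^2$, $\gamma_i^+=\sup_{w\neq0}\langle P_iw,w\rangle/\|w\|^2$, and $C_i=\|P_i\|$ (Euclidean operator norm). Let $Y$ be one of the two cones $$Y_m^+=\Big\{\sum_i\lambda_iP_i:\lambda_i\ge0\Big\},\qquad Y_m^{\bar\kappa}=\Big\{\sum_i\lambda_i^+P_i-\sum_i\lambda_i^-P_i:\ \lambda_i^\pm\ge0,\ \langle\lambda^+,\gamma^-\rangle-\langle\lambda^-,\gamma^+\rangle\ge0,\ \langle\lambda^+,\bar\kappa\gamma^--C\rangle-\langle\lambda^-,\bar\kappa\gamma^++C\rangle\ge0\Big\},$$ with $\bar\kappa\in\mathbb R$. For $P_m(\xi)\in Y$ let $\alpha_m$ be the lowest singular value of $P_m(\xi)A(\xi)$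 and $\kappa$ the condition number $\kappa(B)=\|B\|\,\|B^{-1}\|$ ($=\infty$ if $B$ is singular; the right-hand sides of the bounds on $\kappa$ below are $\infty$ if $\alpha_m=0$). (1) If $P_m(\xi)$ minimizes $\|I-PA(\xi)\|_F$ over $P\in Y$, then $$(1-\alpha_m)^2\le\|I-P_m(\xi)A(\xi)\|_F^2\le n(1-\alpha_m^2),\qquad \kappa(P_m(\xi)A(\xi))\le\frac{\sqrt{n-(n-1)\alpha_m^2}}{\alpha_m},$$ where $0\le\alpha_m\le1$, and $P_m(\xi)A(\xi)=I$ if and only if $\alpha_m=1$. (2) Let $0<\varepsilon\le1$, $\delta>0$, $C>1$ with $\varepsilon'=\varepsilon(C+1)/(C-1)<1$, and let $V\in\mathbb R^{n\times K}$ be a random matrix of one of the following two types. (a) Rescaled Rademacher: the entries of $V$ are independent and equal to $\pm K^{-1/2}$ with probability $1/2$ each, and $K\ge6\varepsilon^{-2}\ln\big(2n(9C/\varepsilon)^{m+1}/\delta\big)$. (b) P-SRHT: with $s=2^{\lceil\log_2n\rceil}$ and $K\le s$, $V$ consists of the first $n$ rows of $K^{-1/2}(RHD)^T$, where $H$ is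 an $s\times s$ Hadamard matrix, $D$ is diagonal with independent uniform $\pm1$ diagonal entries and, independently of $D$, $R$ consists of $K$ rows of the $s\times s$ identity matrix chosen uniformly at random without replacement; and $K\ge2(\varepsilon^2-\varepsilon^3/3)^{-1}\ln\big(4(9C/\varepsilon)^{m+1}/\delta\big)\Big(1+\sqrt{8\ln\big(4n(9C/\varepsilon)^{m+1}/\delta\big)}\Big)^2$. Then, with probability at least $1-\delta$, every $P_m(\xi)$ that minimizes $\|(I-PA(\xi))V\|_F$ over $P\in Y$ satisfies $$(1-\varepsilon')(1-\alpha_m)^2\le\|(I-P_m(\xi)A(\xi))V\|_F^2\le n\big(1-(1-\varepsilon')\alpha_m^2\big),\qquad \kappa(P_m(\xi)A(\xi))\le\alpha_m^{-1}\sqrt{n(1-\varepsilon')^{-1}-(n-1)\alpha_m^2}.$$ -/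

import Mathlib

open scoped ENNReal

noncomputable section

namespace FrobPrecond

/-- Positive definiteness of a real square matrix which is not assumed to be symmetric:
`⟨A w, w⟩ > 0` for every `w ≠ 0`. -/
def IsPositiveDefinite {n : ℕ} (A : Matrix (Fin n) (Fin n) ℝ) : Prop :=
  ∀ w : EuclideanSpace ℝ (Fin n), w ≠ 0 → 0 < inner ℝ (Matrix.toEuclideanLin A w) w

/-- The Frobenius norm, `‖B‖_F ^ 2 = trace (Bᵀ B)`. -/
def frobNorm {n k : ℕ} (B : Matrix (Fin n) (Fin k) ℝ) : ℝ :=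
  √(Matrix.trace (B.transpose * B))

/-- The operator norm of a matrix with respect to the Euclidean norm. -/
def opNorm {n : ℕ} (B : Matrix (Fin n) (Fin n) ℝ) : ℝ :=
  ‖Matrix.toEuclideanCLM (n := Fin n) (𝕜 := ℝ) B‖

/-- The lowest of the `n` singular values of an `n × n` matrix, `n ≥ 1` (Mathlib lists the
singular values in decreasing order, starting from index `0`). -/
def lowestSingularValue {n : ℕ} (B : Matrix (Fin n) (Fin n) ℝ) : ℝ :=
  (Matrix.toEuclideanLin B).singularValues (n - 1)

open Classical in
/-- The condition number `‖B‖ ‖B⁻¹‖`, equal to `∞` when `B` is singular. -/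
def condNumber {n : ℕ} (B : Matrix (Fin n) (Fin n) ℝ) : ℝ≥0∞ :=
  if IsUnit B.det then ENNReal.ofReal (opNorm B * opNorm B⁻¹) else ⊤

/-- `inf_{w ≠ 0} ⟨P w, w⟩ / ‖w‖ ^ 2`. -/
def rayleighInf {n : ℕ} (P : Matrix (Fin n) (Fin n) ℝ) : ℝ :=
  ⨅ w : {w : EuclideanSpace ℝ (Fin n) // w ≠ 0},
    inner ℝ (Matrix.toEuclideanLin P w.1) w.1 / ‖w.1‖ ^ 2

/-- `sup_{w ≠ 0} ⟨P w, w⟩ / ‖w‖ ^ 2`. -/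
def rayleighSup {n : ℕ} (P : Matrix (Fin n) (Fin n) ℝ) : ℝ :=
  ⨆ w : {w : EuclideanSpace ℝ (Fin n) // w ≠ 0},
    inner ℝ (Matrix.toEuclideanLin P w.1) w.1 / ‖w.1‖ ^ 2

/-- The cone `Y_m⁺` of the combinations of `P₁, …, P_m` with nonnegative coefficients. -/
def conePlus {n m : ℕ} (P : Fin m → Matrix (Fin n) (Fin n) ℝ) :
    Set (Matrix (Fin n) (Fin n) ℝ) :=
  {Q | ∃ c : Fin m → ℝ, (∀ i, 0 ≤ c i) ∧ Q = ∑ i, c i • P i}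

/-- The cone `Y_m^κ` of the combinations `∑ c⁺_i P_i - ∑ c⁻_i P_i` with `c⁺, c⁻ ≥ 0`,
`⟨c⁺, γ⁻⟩ - ⟨c⁻, γ⁺⟩ ≥ 0` and `⟨c⁺, κ γ⁻ - C⟩ - ⟨c⁻, κ γ⁺ + C⟩ ≥ 0`. -/
def coneKappa {n m : ℕ} (P : Fin m → Matrix (Fin n) (Fin n) ℝ) (κ : ℝ) :
    Set (Matrix (Fin n) (Fin n) ℝ) :=
  {Q | ∃ cp cm : Fin m → ℝ, (∀ i, 0 ≤ cp i) ∧ (∀ i, 0 ≤ cm i) ∧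
    0 ≤ ∑ i, cp i * rayleighInf (P i) - ∑ i, cm i * rayleighSup (P i) ∧
    0 ≤ ∑ i, cp i * (κ * rayleighInf (P i) - opNorm (P i))
        - ∑ i, cm i * (κ * rayleighSup (P i) + opNorm (P i)) ∧
    Q = ∑ i, cp i • P i - ∑ i, cm i • P i}

/-- `P` is a minimizer over `Y` of `Q ↦ ‖I - Q A‖_F`. -/
def IsFrobProjection {n : ℕ} (Y : Set (Matrix (Fin n) (Fin n) ℝ))
    (A P : Matrix (Fin n) (Fin n) ℝ) : Prop :=
  P ∈ Y ∧ ∀ Q ∈ Y, frobNorm (1 - P * A) ≤ frobNorm (1 - Q * A)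

/-- `P` is a minimizer over `Y` of `Q ↦ ‖(I - Q A) V‖_F`. -/
def IsSemiFrobProjection {n K : ℕ} (Y : Set (Matrix (Fin n) (Fin n) ℝ))
    (A : Matrix (Fin n) (Fin n) ℝ) (V : Matrix (Fin n) (Fin K) ℝ)
    (P : Matrix (Fin n) (Fin n) ℝ) : Prop :=
  P ∈ Y ∧ ∀ Q ∈ Y, frobNorm ((1 - P * A) * V) ≤ frobNorm ((1 - Q * A) * V)

/-- A sign `±1`. -/
def sgn (b : Bool) : ℝ := if b then 1 else -1

/-- The rescaled Rademacher distribution: independent entries, each equal to `± K ^ (-1/2)`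
with probability `1/2`; that is, the array of signs is uniformly distributed. -/
def rademacherLaw (n K : ℕ) : PMF (Matrix (Fin n) (Fin K) ℝ) :=
  (PMF.uniformOfFintype (Fin n → Fin K → Bool)).map
    fun σ => Matrix.of fun i j => (√(K : ℝ))⁻¹ * sgn (σ i j)

/-- The smallest power of `2` which is at least `n`. -/
def srhtOrder (n : ℕ) : ℕ := 2 ^ Nat.clog 2 n

theorem le_srhtOrder (n : ℕ) : n ≤ srhtOrder n := Nat.le_pow_clog one_lt_two n

/-- The `K × s` matrix whose rows are the rows `ρ 0, …, ρ (K - 1)` of the identity. -/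
def rowSelection {K s : ℕ} (ρ : Fin K ↪ Fin s) : Matrix (Fin K) (Fin s) ℝ :=
  (1 : Matrix (Fin s) (Fin s) ℝ).submatrix ρ id

/-- The P-SRHT distribution built on the `s × s` Hadamard matrix `H`, where `s = srhtOrder n`:
the law of the first `n` rows of `K ^ (-1/2) (R H D)ᵀ`, where `D` is diagonal with independent
uniform signs and, independently, `R` consists of `K` rows of the identity chosen uniformly
without replacement. -/
def psrhtLaw (n K : ℕ) (hK : K ≤ srhtOrder n)
    (H : Matrix (Fin (srhtOrder n)) (Fin (srhtOrder n)) ℝ) :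
    PMF (Matrix (Fin n) (Fin K) ℝ) :=
  haveI : Nonempty (Fin K ↪ Fin (srhtOrder n)) := ⟨Fin.castLEEmb hK⟩
  (PMF.uniformOfFintype ((Fin (srhtOrder n) → Bool) × (Fin K ↪ Fin (srhtOrder n)))).map
    fun ω => ((√(K : ℝ))⁻¹ •
      (rowSelection ω.2 * H * Matrix.diagonal (fun i => sgn (ω.1 i))).transpose).submatrix
        (Fin.castLE (le_srhtOrder n)) id

/-- The bounds, for `B = P_m(ξ) A(ξ)`, on the Frobenius semi-norm of `I - B` and on the
condition number of `B`. -/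
def SemiNormBounds {n K : ℕ} (ε' : ℝ) (V : Matrix (Fin n) (Fin K) ℝ)
    (B : Matrix (Fin n) (Fin n) ℝ) : Prop :=
  (1 - ε') * (1 - lowestSingularValue B) ^ 2 ≤ frobNorm ((1 - B) * V) ^ 2 ∧
  frobNorm ((1 - B) * V) ^ 2 ≤ n * (1 - (1 - ε') * lowestSingularValue B ^ 2) ∧
  condNumber B ≤
    ENNReal.ofReal (√(n * (1 - ε')⁻¹ - (n - 1) * lowestSingularValue B ^ 2))
      / ENNReal.ofReal (lowestSingularValue B)

end FrobPrecond

end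

namespace FrobPrecond

/-! Write `B = P * A`. The deterministic core is that `Y` is a cone: a minimizer is in particular
optimal along its own ray, so `B * V` is orthogonal to `(1 - B) * V` and Pythagoras gives `‖V‖² =
‖(1 - B) V‖² + ‖B V‖²` (`frobNorm_sq_eq_add_of_ray_min`). Both random matrices have entries
`±K^(-1/2)`, so `‖V‖² = n` for every outcome. If `V` shrinks the squared norms of `B` and `1 - B` by
at most the factor `1 - ε'`, everything follows from singular values: `‖B‖_F²` is at least `n α²`,
and at least the squared operator norm plus `(n - 1) α²`, while testing `1 - B` on a lowest right
singular vector gives `(1 - α)²` (`semiNormBounds_of_embedding`). Part (1) is the case `V = 1`, `ε'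
= 0`.

The minimizer depends on `V`, so the embedding property must hold uniformly on the span of `1` and
the `P i * A`, of dimension at most `m + 1`. A net of at most `(9C/ε)^(m+1)` points on its Frobenius
unit sphere reduces this to a union bound over fixed `X` with `‖X‖ = 1`, for which `1 - ε ≤ ‖X V‖² ≤
9` is enough: the crude upper bound only controls the error of passing from the net to the sphere
(`card_not_embedding_le`).

For a fixed `X` the tails come from exponential moments. Fourth moments of Rademacher sums control
the lower tail, Gaussian linearization the upper one, and Jensen's inequality passes from vectors to
matrices. For the P-SRHT, the random signs first make all row energies small; then rows are sampled
without replacement, which Maclaurin's inequality compares with independent sampling. All laws are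
uniform on finite sets, so probabilities are treated as counts. -/

theorem frobNorm_sq {n k : ℕ} (B : Matrix (Fin n) (Fin k) ℝ) :
    frobNorm B ^ 2 = ∑ i, ∑ j, B i j ^ 2 := by
  have h : Matrix.trace (B.transpose * B) = ∑ i, ∑ j, B i j ^ 2 := by
    rw [Finset.sum_comm]
    simp [Matrix.trace, Matrix.mul_apply, sq]
  rw [frobNorm, h, Real.sq_sqrt (by positivity)]

theorem frobNorm_nonneg {n k : ℕ} (B : Matrix (Fin n) (Fin k) ℝ) : 0 ≤ frobNorm B :=
  Real.sqrt_nonneg _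

/-- Parseval's identity in the basis `b`, applied to each row of `B`. -/
theorem frobNorm_sq_eq_sum_norm_sq {n : ℕ} {ι : Type*} [Fintype ι] (B : Matrix (Fin n) (Fin n) ℝ)
    (b : OrthonormalBasis ι ℝ (EuclideanSpace ℝ (Fin n))) :
    frobNorm B ^ 2 = ∑ k, ‖Matrix.toEuclideanLin B (b k)‖ ^ 2 := by
  rw [frobNorm_sq]
  simp_rw [EuclideanSpace.norm_sq_eq]
  conv_rhs => rw [Finset.sum_comm]
  refine Finset.sum_congr rfl fun i _ => ?_
  have h := b.sum_sq_norm_inner_left (WithLp.toLp 2 (B i))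
  rw [EuclideanSpace.norm_sq_eq] at h
  simp only [Real.norm_eq_abs, sq_abs] at h ⊢
  rw [← h]
  refine Finset.sum_congr rfl fun k _ => ?_
  simp [PiLp.inner_apply, Matrix.mulVec, dotProduct, Matrix.toLpLin_apply, mul_comm]

/-! ### Singular values, Frobenius norm and condition number -/

section SingularValues

variable {n : ℕ} (B : Matrix (Fin n) (Fin n) ℝ)

/-- The right singular vectors of a square matrix. -/
theorem exists_singular_basis :
    ∃ b : OrthonormalBasis (Fin n) ℝ (EuclideanSpace ℝ (Fin n)), ∀ x,
      ‖Matrix.toEuclideanLin B x‖ ^ 2 =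
        ∑ i : Fin n, (Matrix.toEuclideanLin B).singularValues i ^ 2 * inner ℝ (b i) x ^ 2 := by
  set T := Matrix.toEuclideanLin B
  have hfr : Module.finrank ℝ (EuclideanSpace ℝ (Fin n)) = n := by simp
  let hT := T.isSymmetric_adjoint_comp_self
  refine ⟨hT.eigenvectorBasis hfr, fun x => ?_⟩
  have h1 : ‖T x‖ ^ 2 = inner ℝ x ((LinearMap.adjoint T ∘ₗ T) x) := by
    rw [LinearMap.comp_apply, LinearMap.adjoint_inner_right, real_inner_self_eq_norm_sq]
  rw [h1, ← (hT.eigenvectorBasis hfr).sum_inner_mul_inner]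
  refine Finset.sum_congr rfl fun i _ => ?_
  rw [← hT, hT.apply_eigenvectorBasis, T.sq_singularValues_fin hfr, real_inner_comm x]
  simp only [RCLike.ofReal_real_eq_id, id_eq, inner_smul_right, real_inner_comm x]
  ring

theorem lowestSingularValue_nonneg : 0 ≤ lowestSingularValue B :=
  LinearMap.singularValues_nonneg _ _

theorem lowestSingularValue_le (i : Fin n) :
    lowestSingularValue B ≤ (Matrix.toEuclideanLin B).singularValues i :=
  LinearMap.singularValues_antitone _ (by omega)

theorem lowestSingularValue_mul_norm_le (x : EuclideanSpace ℝ (Fin n)) :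
    lowestSingularValue B * ‖x‖ ≤ ‖Matrix.toEuclideanLin B x‖ := by
  obtain ⟨b, hb⟩ := exists_singular_basis B
  refine le_of_sq_le_sq ?_ (norm_nonneg _)
  rw [hb, mul_pow, ← b.sum_sq_norm_inner_right x, Finset.mul_sum]
  refine Finset.sum_le_sum fun i _ => ?_
  rw [Real.norm_eq_abs, sq_abs]
  gcongr
  exacts [lowestSingularValue_nonneg B, lowestSingularValue_le B i]

theorem norm_apply_basis {b : OrthonormalBasis (Fin n) ℝ (EuclideanSpace ℝ (Fin n))}
    (hb : ∀ x, ‖Matrix.toEuclideanLin B x‖ ^ 2 =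
        ∑ i : Fin n, (Matrix.toEuclideanLin B).singularValues i ^ 2 * inner ℝ (b i) x ^ 2)
    (i : Fin n) :
    ‖Matrix.toEuclideanLin B (b i)‖ ^ 2 = (Matrix.toEuclideanLin B).singularValues i ^ 2 := by
  rw [hb, Finset.sum_eq_single i]
  · simp
  · intro j _ hj
    simp [b.inner_eq_ite, hj]
  · simp

theorem exists_norm_eq_lowestSingularValue (hn : 0 < n) :
    ∃ x, ‖x‖ = 1 ∧ ‖Matrix.toEuclideanLin B x‖ = lowestSingularValue B := by
  obtain ⟨b, hb⟩ := exists_singular_basis B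
  refine ⟨b ⟨n - 1, by omega⟩, by simp, ?_⟩
  have := norm_apply_basis B hb ⟨n - 1, by omega⟩
  exact (sq_eq_sq₀ (norm_nonneg _) (lowestSingularValue_nonneg B)).1 this

theorem frobNorm_sq_eq_sum_singularValues :
    frobNorm B ^ 2 = ∑ i : Fin n, (Matrix.toEuclideanLin B).singularValues i ^ 2 := by
  obtain ⟨b, hb⟩ := exists_singular_basis B
  rw [frobNorm_sq_eq_sum_norm_sq B b]
  exact Finset.sum_congr rfl fun i _ => norm_apply_basis B hb i

theorem norm_apply_le_frobNorm_mul (x : EuclideanSpace ℝ (Fin n)) :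
    ‖Matrix.toEuclideanLin B x‖ ≤ frobNorm B * ‖x‖ := by
  obtain ⟨b, hb⟩ := exists_singular_basis B
  refine le_of_sq_le_sq ?_ (mul_nonneg (frobNorm_nonneg B) (norm_nonneg _))
  rw [hb, mul_pow, ← b.sum_sq_norm_inner_right x, Finset.mul_sum,
    frobNorm_sq_eq_sum_singularValues]
  refine Finset.sum_le_sum fun i _ => ?_
  rw [Real.norm_eq_abs, sq_abs]
  gcongr
  exact Finset.single_le_sum (f := fun i : Fin n =>
    (Matrix.toEuclideanLin B).singularValues i ^ 2) (fun _ _ => sq_nonneg _) (Finset.mem_univ i)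

theorem opNorm_sq_le :
    opNorm B ^ 2 ≤ (Matrix.toEuclideanLin B).singularValues 0 ^ 2 := by
  obtain ⟨b, hb⟩ := exists_singular_basis B
  have h0 := LinearMap.singularValues_nonneg (Matrix.toEuclideanLin B) 0
  refine pow_le_pow_left₀ (norm_nonneg _) ?_ 2
  refine ContinuousLinearMap.opNorm_le_bound _ h0 fun x => ?_
  refine le_of_sq_le_sq ?_ (mul_nonneg h0 (norm_nonneg _))
  change ‖Matrix.toEuclideanLin B x‖ ^ 2 ≤ _
  rw [hb, mul_pow, ← b.sum_sq_norm_inner_right x, Finset.mul_sum]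
  refine Finset.sum_le_sum fun i _ => ?_
  rw [Real.norm_eq_abs, sq_abs]
  gcongr
  · exact LinearMap.singularValues_nonneg _ _
  · exact LinearMap.singularValues_antitone _ (Nat.zero_le _)

/-- The largest singular value accounts for the operator norm; each of the other `n - 1` is at least
the lowest one. -/
theorem opNorm_sq_add_le (hn : 0 < n) :
    opNorm B ^ 2 + (n - 1) * lowestSingularValue B ^ 2 ≤ frobNorm B ^ 2 := by
  obtain ⟨n, rfl⟩ := Nat.exists_eq_succ_of_ne_zero hn.ne'
  rw [frobNorm_sq_eq_sum_singularValues, Fin.sum_univ_succ]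
  refine add_le_add (opNorm_sq_le B) ?_
  have : ∑ i : Fin n, lowestSingularValue B ^ 2 ≤
      ∑ i : Fin n, (Matrix.toEuclideanLin B).singularValues (i.succ : ℕ) ^ 2 :=
    Finset.sum_le_sum fun i _ =>
      pow_le_pow_left₀ (lowestSingularValue_nonneg B) (lowestSingularValue_le B _) 2
  simpa using this

theorem card_mul_lowestSingularValue_sq_le :
    n * lowestSingularValue B ^ 2 ≤ frobNorm B ^ 2 := by
  rw [frobNorm_sq_eq_sum_singularValues]
  have : ∑ i : Fin n, lowestSingularValue B ^ 2 ≤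
      ∑ i : Fin n, (Matrix.toEuclideanLin B).singularValues (i : ℕ) ^ 2 :=
    Finset.sum_le_sum fun i _ =>
      pow_le_pow_left₀ (lowestSingularValue_nonneg B) (lowestSingularValue_le B _) 2
  simpa using this

/-- On a unit vector `x` with `‖B x‖ = α`, the reverse triangle inequality gives `|1 - α| ≤ ‖(1 - B)
x‖`. -/
theorem one_sub_lowestSingularValue_sq_le (hn : 0 < n) :
    (1 - lowestSingularValue B) ^ 2 ≤ frobNorm (1 - B) ^ 2 := by
  obtain ⟨x, hx, hB⟩ := exists_norm_eq_lowestSingularValue B hn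
  have h := norm_apply_le_frobNorm_mul (1 - B) x
  have h2 := abs_norm_sub_norm_le x (Matrix.toEuclideanLin B x)
  have h3 : Matrix.toEuclideanLin (1 - B) x = x - Matrix.toEuclideanLin B x := by
    simp [Matrix.toLpLin_one]
  rw [h3, hx, mul_one] at h
  rw [hx, hB] at h2
  exact sq_le_sq.2 ((h2.trans h).trans (le_abs_self _))

theorem lowestSingularValue_pos_iff (hn : 0 < n) :
    0 < lowestSingularValue B ↔ IsUnit B.det := by
  rw [isUnit_iff_ne_zero]
  constructor
  · intro h hdet
    obtain ⟨v, hv, hv0⟩ := Matrix.exists_mulVec_eq_zero_iff.2 hdet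
    have := lowestSingularValue_mul_norm_le B (WithLp.toLp 2 v)
    rw [Matrix.toLpLin_toLp] at this
    have h2 : 0 < ‖(WithLp.toLp 2 v : EuclideanSpace ℝ (Fin n))‖ := by
      rw [norm_pos_iff]
      simpa using hv
    simp [hv0] at this
    nlinarith
  · intro h
    refine (lowestSingularValue_nonneg B).lt_of_ne fun h0 => ?_
    obtain ⟨x, hx, hB⟩ := exists_norm_eq_lowestSingularValue B hn
    rw [← h0, norm_eq_zero, Matrix.toLpLin_apply] at hB
    refine h (Matrix.exists_mulVec_eq_zero_iff.1 ⟨x.ofLp, fun hx0 => ?_, by simpa using hB⟩)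
    have : x = 0 := by ext i; simp [hx0]
    simp [this] at hx

theorem condNumber_le (hn : 0 < n) {R : ℝ} (hR : 0 < R)
    (h : lowestSingularValue B ≠ 0 → opNorm B ^ 2 ≤ R) :
    condNumber B ≤ ENNReal.ofReal (√R) / ENNReal.ofReal (lowestSingularValue B) := by
  rcases (lowestSingularValue_nonneg B).eq_or_lt with h0 | h0
  -- In `ℝ≥0∞` one has `0 / 0 = 0`, so the right-hand side is `∞` here only because `R` is positive.
  · rw [← h0, ENNReal.ofReal_zero, ENNReal.div_zero]
    · exact le_top
    · simpa using hR
  · have hu := (lowestSingularValue_pos_iff B hn).1 h0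
    rw [condNumber, if_pos hu, ← ENNReal.ofReal_div_of_pos h0, div_eq_mul_inv]
    refine ENNReal.ofReal_le_ofReal (mul_le_mul (Real.le_sqrt_of_sq_le (h h0.ne')) ?_
      (norm_nonneg _) (Real.sqrt_nonneg _))
    refine ContinuousLinearMap.opNorm_le_bound _ (inv_nonneg.2 h0.le) fun x => ?_
    rw [← div_eq_inv_mul, le_div_iff₀ h0, mul_comm]
    refine (lowestSingularValue_mul_norm_le B _).trans_eq ?_
    have : Matrix.toEuclideanLin B ((Matrix.toEuclideanCLM (n := Fin n) (𝕜 := ℝ) B⁻¹) x) = x := by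
      change Matrix.toEuclideanLin B (Matrix.toEuclideanLin B⁻¹ x) = x
      simp [Matrix.toLpLin_apply, Matrix.mul_nonsing_inv B hu]
    rw [this]

end SingularValues


/-! ### Projection onto a cone and the deterministic bounds -/

/-- A minimizer of the distance of `X` to a ray is an orthogonal projection. -/
theorem frobNorm_sq_eq_add_of_ray_min {n k : ℕ} {X Z : Matrix (Fin n) (Fin k) ℝ}
    (h : ∀ t : ℝ, 0 ≤ t → frobNorm (X - Z) ≤ frobNorm (X - t • Z)) :
    frobNorm X ^ 2 = frobNorm (X - Z) ^ 2 + frobNorm Z ^ 2 := by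
  set p := ∑ i, ∑ j, X i j * Z i j with hp
  set q := frobNorm Z ^ 2 with hq
  have hexp : ∀ t : ℝ, frobNorm (X - t • Z) ^ 2 = frobNorm X ^ 2 - 2 * t * p + t ^ 2 * q := by
    intro t
    rw [hq, hp, frobNorm_sq, frobNorm_sq, frobNorm_sq]
    simp only [Finset.mul_sum, ← Finset.sum_sub_distrib, ← Finset.sum_add_distrib]
    refine Finset.sum_congr rfl fun i _ => Finset.sum_congr rfl fun j _ => ?_
    simp
    ring
  have h1 := hexp 1
  rw [one_smul] at h1
  have key : ∀ t : ℝ, 0 ≤ t → -2 * p + q ≤ -2 * t * p + t ^ 2 * q := by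
    intro t ht
    have := pow_le_pow_left₀ (frobNorm_nonneg _) (h t ht) 2
    rw [h1, hexp t] at this
    linarith
  -- The value `t = 1` minimizes a quadratic over `t ≥ 0` and is interior, so the derivative
  -- vanishes there. The comparison is made at the vertex `p / q`, which is nonnegative by the case
  -- `t = 0`; if `q = 0` the function is affine, and `t = 0` and `t = 2` suffice.
  have hpq : p = q := by
    have hq0 : 0 ≤ q := sq_nonneg _
    have k0 := key 0 le_rfl
    rcases hq0.eq_or_lt with h0 | h0
    · have k2 := key 2 (by norm_num)
      rw [← h0] at k0 k2 ⊢
      linarith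
    · have k1 := key (p / q) (div_nonneg (by linarith) h0.le)
      have e : -2 * (p / q) * p + (p / q) ^ 2 * q = -(p ^ 2 / q) := by
        field_simp
        ring
      rw [e] at k1
      have k2 : p ^ 2 / q ≤ 2 * p - q := by linarith
      rw [div_le_iff₀ h0] at k2
      have : (p - q) ^ 2 ≤ 0 := by linarith
      have := pow_eq_zero_iff (two_ne_zero) |>.1 (le_antisymm this (sq_nonneg _))
      linarith
  rw [h1, hpq]
  ring

theorem frobNorm_one_sq (n : ℕ) : frobNorm (1 : Matrix (Fin n) (Fin n) ℝ) ^ 2 = n := by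
  rw [frobNorm_sq]
  simp [Matrix.one_apply]

theorem smul_mem_conePlus {n m : ℕ} {P : Fin m → Matrix (Fin n) (Fin n) ℝ}
    {Q : Matrix (Fin n) (Fin n) ℝ} (hQ : Q ∈ conePlus P) {t : ℝ} (ht : 0 ≤ t) :
    t • Q ∈ conePlus P := by
  obtain ⟨c, hc, rfl⟩ := hQ
  exact ⟨fun i => t * c i, fun i => mul_nonneg ht (hc i), by
    simp [Finset.smul_sum, mul_smul]⟩

theorem smul_mem_coneKappa {n m : ℕ} {P : Fin m → Matrix (Fin n) (Fin n) ℝ} {κ : ℝ}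
    {Q : Matrix (Fin n) (Fin n) ℝ} (hQ : Q ∈ coneKappa P κ) {t : ℝ} (ht : 0 ≤ t) :
    t • Q ∈ coneKappa P κ := by
  obtain ⟨cp, cm, hp, hm, h1, h2, rfl⟩ := hQ
  refine ⟨fun i => t * cp i, fun i => t * cm i, fun i => mul_nonneg ht (hp i),
    fun i => mul_nonneg ht (hm i), ?_, ?_, ?_⟩
  · simp only [mul_assoc, ← Finset.mul_sum, ← mul_sub]
    exact mul_nonneg ht h1
  · simp only [mul_assoc, ← Finset.mul_sum, ← mul_sub]
    exact mul_nonneg ht h2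
  · simp [Finset.smul_sum, mul_smul, smul_sub]

theorem conePlus_subset_span {n m : ℕ} (P : Fin m → Matrix (Fin n) (Fin n) ℝ) :
    conePlus P ⊆ Submodule.span ℝ (Set.range P) := by
  rintro _ ⟨c, -, rfl⟩
  exact Submodule.sum_mem _ fun i _ =>
    Submodule.smul_mem _ _ (Submodule.subset_span ⟨i, rfl⟩)

theorem coneKappa_subset_span {n m : ℕ} (P : Fin m → Matrix (Fin n) (Fin n) ℝ) (κ : ℝ) :
    coneKappa P κ ⊆ Submodule.span ℝ (Set.range P) := by
  rintro _ ⟨cp, cm, -, -, -, -, rfl⟩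
  exact Submodule.sub_mem _
    (Submodule.sum_mem _ fun i _ => Submodule.smul_mem _ _ (Submodule.subset_span ⟨i, rfl⟩))
    (Submodule.sum_mem _ fun i _ => Submodule.smul_mem _ _ (Submodule.subset_span ⟨i, rfl⟩))

/-- The bounds for a semi-projection follow from a one-sided embedding property of `V` on the
two matrices `B` and `1 - B`. -/
theorem semiNormBounds_of_embedding {n K : ℕ} (hn : 0 < n) {ε' : ℝ} (h1 : ε' < 1)
    {Y : Set (Matrix (Fin n) (Fin n) ℝ)} (hY : ∀ Q ∈ Y, ∀ t : ℝ, 0 ≤ t → t • Q ∈ Y)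
    {A P : Matrix (Fin n) (Fin n) ℝ} {V : Matrix (Fin n) (Fin K) ℝ} (hV : frobNorm V ^ 2 = n)
    (hP : IsSemiFrobProjection Y A V P)
    (hB : (1 - ε') * frobNorm (P * A) ^ 2 ≤ frobNorm (P * A * V) ^ 2)
    (hIB : (1 - ε') * frobNorm (1 - P * A) ^ 2 ≤ frobNorm ((1 - P * A) * V) ^ 2) :
    SemiNormBounds ε' V (P * A) := by
  have horth : frobNorm V ^ 2 = frobNorm ((1 - P * A) * V) ^ 2 + frobNorm (P * A * V) ^ 2 := by
    have := frobNorm_sq_eq_add_of_ray_min (X := V) (Z := P * A * V) fun t ht => by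
      have := hP.2 _ (hY P hP.1 t ht)
      simpa only [Matrix.sub_mul, Matrix.one_mul, Matrix.smul_mul] using this
    simpa only [Matrix.sub_mul, Matrix.one_mul] using this
  rw [hV] at horth
  have hpos : 0 < 1 - ε' := by linarith
  have hα := card_mul_lowestSingularValue_sq_le (P * A)
  have hn1 : (1 : ℝ) ≤ n := by exact_mod_cast hn
  refine ⟨?_, ?_, condNumber_le _ hn ?_ fun _ => ?_⟩
  · exact (mul_le_mul_of_nonneg_left (one_sub_lowestSingularValue_sq_le _ hn) hpos.le).trans hIB
  · nlinarith
  -- Positivity of the radicand: it is `n / (1 - ε')` if `α = 0`, and otherwise at least `α²`,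
  -- because `n α² ≤ n / (1 - ε')`.
  · have h2 : (1 - ε') * (n * lowestSingularValue (P * A) ^ 2) ≤ n := by
      nlinarith [sq_nonneg (frobNorm ((1 - P * A) * V))]
    have h3 : n * lowestSingularValue (P * A) ^ 2 ≤ n * (1 - ε')⁻¹ := by
      rw [← div_eq_mul_inv, le_div_iff₀ hpos]
      linarith
    rcases (sq_nonneg (lowestSingularValue (P * A))).eq_or_lt with h4 | h4
    · rw [← h4]
      have := inv_pos.2 hpos
      nlinarith
    · linarith
  · have h2 := opNorm_sq_add_le (P * A) hn
    have h3 : frobNorm (P * A) ^ 2 ≤ n * (1 - ε')⁻¹ := by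
      rw [← div_eq_mul_inv, le_div_iff₀ hpos]
      nlinarith [sq_nonneg (frobNorm ((1 - P * A) * V))]
    linarith

theorem frobNorm_eq_zero {n k : ℕ} {B : Matrix (Fin n) (Fin k) ℝ} (h : frobNorm B ^ 2 ≤ 0) :
    B = 0 := by
  rw [frobNorm_sq] at h
  have h2 := le_antisymm h (by positivity)
  ext i j
  have h3 := (Finset.sum_eq_zero_iff_of_nonneg (fun i _ => by positivity)).1 h2 i (by simp)
  have h4 := (Finset.sum_eq_zero_iff_of_nonneg (fun i _ => by positivity)).1 h3 j (by simp)
  simpa using h4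

theorem lowestSingularValue_one {n : ℕ} (hn : 0 < n) :
    lowestSingularValue (1 : Matrix (Fin n) (Fin n) ℝ) = 1 := by
  obtain ⟨x, hx, hB⟩ := exists_norm_eq_lowestSingularValue (1 : Matrix (Fin n) (Fin n) ℝ) hn
  rw [← hB]
  simpa [Matrix.toLpLin_one] using hx

theorem frobProjection_bounds {n : ℕ} (hn : 0 < n)
    {Y : Set (Matrix (Fin n) (Fin n) ℝ)} (hY : ∀ Q ∈ Y, ∀ t : ℝ, 0 ≤ t → t • Q ∈ Y)
    {A P : Matrix (Fin n) (Fin n) ℝ} (hP : IsFrobProjection Y A P) :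
    (1 - lowestSingularValue (P * A)) ^ 2 ≤ frobNorm (1 - P * A) ^ 2 ∧
      frobNorm (1 - P * A) ^ 2 ≤ n * (1 - lowestSingularValue (P * A) ^ 2) ∧
      0 ≤ lowestSingularValue (P * A) ∧
      lowestSingularValue (P * A) ≤ 1 ∧
      (P * A = 1 ↔ lowestSingularValue (P * A) = 1) ∧
      condNumber (P * A) ≤
        ENNReal.ofReal (√(n - (n - 1) * lowestSingularValue (P * A) ^ 2))
          / ENNReal.ofReal (lowestSingularValue (P * A)) := by
  -- The semi-norm result with `V = 1` and no distortion.
  have hP' : IsSemiFrobProjection Y A (1 : Matrix (Fin n) (Fin n) ℝ) P := by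
    simpa [IsSemiFrobProjection, IsFrobProjection] using hP
  obtain ⟨b1, b2, b3⟩ := semiNormBounds_of_embedding hn one_pos hY (frobNorm_one_sq n) hP'
    (by simp) (by simp)
  simp only [sub_zero, one_mul, mul_one, inv_one] at b1 b2 b3
  have hn0 : (0 : ℝ) < n := by exact_mod_cast hn
  refine ⟨b1, b2, lowestSingularValue_nonneg _, ?_, ⟨fun h => ?_, fun h => ?_⟩, b3⟩
  · have h1 : 0 ≤ 1 - lowestSingularValue (P * A) ^ 2 :=
      nonneg_of_mul_nonneg_right ((sq_nonneg _).trans b2) hn0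
    nlinarith [lowestSingularValue_nonneg (P * A)]
  · rw [h, lowestSingularValue_one hn]
  · rw [h] at b2
    have := frobNorm_eq_zero (b2.trans (by simp))
    exact (sub_eq_zero.1 this).symm

/-! ### Nets -/

-- Volume comparison: the balls of radius `r / 2` around the points are disjoint and contained in
-- the ball of radius `1 + r / 2`.
open MeasureTheory Metric in
theorem card_le_of_separated_unit_ball {E : Type*} [NormedAddCommGroup E] [NormedSpace ℝ E]
    [FiniteDimensional ℝ E] {r : ℝ} (hr : 0 < r) (s : Finset E) (hs : ∀ c ∈ s, ‖c‖ ≤ 1)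
    (h : ∀ c ∈ s, ∀ d ∈ s, c ≠ d → r ≤ ‖c - d‖) :
    (s.card : ℝ) ≤ (1 + 2 / r) ^ Module.finrank ℝ E := by
  borelize E
  let μ : Measure E := Measure.addHaar
  set A := ⋃ c ∈ s, ball (c : E) (r / 2) with hA
  have hr2 : 0 < r / 2 := by positivity
  have hR : 0 < 1 + r / 2 := by positivity
  have D : Set.Pairwise (s : Set E) (Function.onFun Disjoint fun c => ball (c : E) (r / 2)) := by
    rintro c hc d hd hcd
    apply ball_disjoint_ball
    rw [dist_eq_norm]
    linarith [h c hc d hd hcd]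
  have A_subset : A ⊆ ball (0 : E) (1 + r / 2) := by
    refine Set.iUnion₂_subset fun x hx => ?_
    apply ball_subset_ball'
    rw [dist_zero_right]
    linarith [hs x hx]
  have I : (s.card : ℝ≥0∞) * ENNReal.ofReal ((r / 2) ^ Module.finrank ℝ E) * μ (ball 0 1) ≤
      ENNReal.ofReal ((1 + r / 2) ^ Module.finrank ℝ E) * μ (ball 0 1) :=
    calc
      (s.card : ℝ≥0∞) * ENNReal.ofReal ((r / 2) ^ Module.finrank ℝ E) * μ (ball 0 1) = μ A := by
        rw [hA, measure_biUnion_finset D fun c _ => measurableSet_ball]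
        simp only [μ.addHaar_ball_of_pos _ hr2]
        simp only [Finset.sum_const, nsmul_eq_mul, mul_assoc]
      _ ≤ μ (ball (0 : E) (1 + r / 2)) := measure_mono A_subset
      _ = ENNReal.ofReal ((1 + r / 2) ^ Module.finrank ℝ E) * μ (ball 0 1) := by
        simp only [μ.addHaar_ball_of_pos _ hR]
  have J : (s.card : ℝ≥0∞) * ENNReal.ofReal ((r / 2) ^ Module.finrank ℝ E) ≤
      ENNReal.ofReal ((1 + r / 2) ^ Module.finrank ℝ E) :=
    (ENNReal.mul_le_mul_iff_left (measure_ball_pos _ _ zero_lt_one).ne' measure_ball_lt_top.ne).1 I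
  have K := ENNReal.toReal_le_of_le_ofReal (pow_nonneg hR.le _) J
  rw [ENNReal.toReal_mul, ENNReal.toReal_natCast, ENNReal.toReal_ofReal (by positivity),
    ← le_div_iff₀ (by positivity), ← div_pow] at K
  refine K.trans_eq ?_
  congr 1
  field_simp
  ring

theorem exists_sphere_net {E : Type*} [NormedAddCommGroup E] [NormedSpace ℝ E]
    [FiniteDimensional ℝ E] {r : ℝ} (hr : 0 < r) :
    ∃ s : Finset E, (∀ c ∈ s, ‖c‖ = 1) ∧ (∀ x : E, ‖x‖ = 1 → ∃ c ∈ s, ‖x - c‖ ≤ r) ∧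
      (s.card : ℝ) ≤ (1 + 2 / r) ^ Module.finrank ℝ E := by
  classical
  let p : ℕ → Prop := fun k => ∃ s : Finset E, s.card = k ∧ (∀ c ∈ s, ‖c‖ = 1) ∧
    ∀ c ∈ s, ∀ d ∈ s, c ≠ d → r ≤ ‖c - d‖
  have hbound : ∀ k, p k → k ≤ ⌊(1 + 2 / r) ^ Module.finrank ℝ E⌋₊ := by
    rintro _ ⟨s, rfl, h1, h2⟩
    exact Nat.le_floor (card_le_of_separated_unit_ball hr s (fun c hc => (h1 c hc).le) h2)
  have hp0 : p 0 := ⟨∅, by simp⟩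
  -- A separated subset of the sphere of maximal cardinality is a net, since a point far from it
  -- could be added.
  obtain ⟨s, hcard, h1, h2⟩ :
      p (Nat.findGreatest p ⌊(1 + 2 / r) ^ Module.finrank ℝ E⌋₊) :=
    Nat.findGreatest_spec (P := p) (Nat.zero_le _) hp0
  refine ⟨s, h1, fun x hx => ?_, card_le_of_separated_unit_ball hr s (fun c hc => (h1 c hc).le) h2⟩
  by_contra! hfar
  have hxs : x ∉ s := fun hxs => by
    have := hfar x hxs
    simp at this
    linarith
  have hp : p (s.card + 1) := by
    refine ⟨insert x s, Finset.card_insert_of_notMem hxs, ?_, ?_⟩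
    · simpa [hx] using h1
    · intro c hc d hd hcd
      rcases Finset.mem_insert.1 hc with rfl | hc' <;>
        rcases Finset.mem_insert.1 hd with rfl | hd'
      · exact absurd rfl hcd
      · exact (hfar d hd').le
      · rw [norm_sub_rev]
        exact (hfar c hc').le
      · exact h2 c hc' d hd' hcd
  have := Nat.le_findGreatest (hbound _ hp) hp
  omega

/-- From a net to the whole sphere. -/
theorem norm_lower_bound_of_net {E F : Type*} [NormedAddCommGroup E] [NormedSpace ℝ E]
    [FiniteDimensional ℝ E] [NormedAddCommGroup F] [NormedSpace ℝ F] (f : E →ₗ[ℝ] F)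
    {r a b : ℝ} (hr0 : 0 ≤ r) (hr1 : r < 1) (hb : 0 ≤ b) (s : Finset E)
    (hnet : ∀ x : E, ‖x‖ = 1 → ∃ c ∈ s, ‖x - c‖ ≤ r)
    (ha : ∀ c ∈ s, a ≤ ‖f c‖) (hb' : ∀ c ∈ s, ‖f c‖ ≤ b) (x : E) :
    (a - r * (b / (1 - r))) * ‖x‖ ≤ ‖f x‖ := by
  let g : E →L[ℝ] F := LinearMap.toContinuousLinearMap f
  have hg : ∀ x, g x = f x := fun _ => rfl
  -- The operator norm is bounded by itself: moving a unit vector to the net costs at most `r *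
  -- ‖g‖`, which is absorbed on the left since `r < 1`.
  have hM : ‖g‖ ≤ b + r * ‖g‖ := by
    refine ContinuousLinearMap.opNorm_le_of_unit_norm (by positivity) fun y hy => ?_
    obtain ⟨c, hc, hyc⟩ := hnet y hy
    calc ‖g y‖ = ‖g c + g (y - c)‖ := by simp
      _ ≤ ‖g c‖ + ‖g (y - c)‖ := norm_add_le _ _
      _ ≤ b + ‖g‖ * ‖y - c‖ := add_le_add (hb' c hc) (g.le_opNorm _)
      _ ≤ b + r * ‖g‖ := by
        rw [mul_comm r]
        gcongr
  have hM' : ‖g‖ ≤ b / (1 - r) := by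
    rw [le_div_iff₀ (by linarith)]
    linarith
  rcases eq_or_ne x 0 with rfl | hx
  · simp
  have hx0 : 0 < ‖x‖ := norm_pos_iff.2 hx
  have hu : ‖(‖x‖⁻¹ • x : E)‖ = 1 := by
    rw [norm_smul, norm_inv, norm_norm, inv_mul_cancel₀ hx0.ne']
  obtain ⟨c, hc, hyc⟩ := hnet _ hu
  have h1 : a - r * (b / (1 - r)) ≤ ‖g (‖x‖⁻¹ • x)‖ := by
    have h2 : ‖g c‖ ≤ ‖g (‖x‖⁻¹ • x)‖ + ‖g (‖x‖⁻¹ • x - c)‖ := by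
      rw [map_sub]
      exact norm_le_norm_add_norm_sub _ _
    have h3 : ‖g (‖x‖⁻¹ • x - c)‖ ≤ r * (b / (1 - r)) := by
      refine (g.le_opNorm _).trans ?_
      rw [mul_comm]
      gcongr
    have h4 : a ≤ ‖g c‖ := ha c hc
    linarith
  rw [map_smul, norm_smul, norm_inv, norm_norm, ← div_eq_inv_mul, le_div_iff₀ hx0] at h1
  exact h1

theorem net_radius_bound {ε C : ℝ} (h0 : 0 < ε) (h1 : ε ≤ 1) (hC : 1 < C)
    (h : ε * (C + 1) / (C - 1) < 1) :
    √(1 - ε * (C + 1) / (C - 1)) ≤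
      √(1 - ε) - ε / (4 * C) * (3 / (1 - ε / (4 * C))) := by
  have hC1 : 0 < C - 1 := by linarith
  set ε' := ε * (C + 1) / (C - 1) with hε'
  have e1 : ε' - ε = 2 * (ε / (C - 1)) := by
    rw [hε']
    field_simp
    ring
  have e2 : ε / (4 * C) * (3 / (1 - ε / (4 * C))) ≤ ε / (C - 1) := by
    have : 1 - ε / (4 * C) = (4 * C - ε) / (4 * C) := by field_simp
    rw [this]
    have h4 : 0 < 4 * C - ε := by linarith
    have : ε / (4 * C) * (3 / ((4 * C - ε) / (4 * C))) = ε * (3 / (4 * C - ε)) := by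
      field_simp
    rw [this, div_eq_mul_one_div ε (C - 1)]
    gcongr ε * ?_
    rw [div_le_div_iff₀ h4 hC1]
    linarith
  have hpos : 0 < ε / (C - 1) := by positivity
  set u := ε / (C - 1)
  have hA : √(1 - ε) ^ 2 = 1 - ε := Real.sq_sqrt (by linarith)
  have hB : √(1 - ε') ^ 2 = 1 - ε' := Real.sq_sqrt (by linarith)
  have hA1 : √(1 - ε) < 1 := (Real.sqrt_lt' one_pos).2 (by linarith)
  have hB1 : √(1 - ε') ≤ 1 := Real.sqrt_le_one.2 (by linarith)
  have hA0 := Real.sqrt_nonneg (1 - ε)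
  have hB0 := Real.sqrt_nonneg (1 - ε')
  -- The difference of the radicands is `2u` and the two roots sum to less than `2`.
  have : u ≤ √(1 - ε) - √(1 - ε') := by
    by_contra! hlt
    nlinarith [mul_nonneg (add_nonneg hA0 hB0) (sub_nonneg.2 hlt.le),
      mul_pos hpos (show 0 < 2 - (√(1 - ε) + √(1 - ε')) by linarith)]
  linarith


/-! ### Moments of Rademacher sums -/

/-- The Rademacher sum `∑ ± x_i`. -/
def signSum {n : ℕ} (x : Fin n → ℝ) (σ : Fin n → Bool) : ℝ := ∑ i, x i * sgn (σ i)

theorem sgn_sq (b : Bool) : sgn b ^ 2 = 1 := by cases b <;> simp [sgn]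

theorem sum_signs_succ {n : ℕ} (f : (Fin (n + 1) → Bool) → ℝ) :
    ∑ σ, f σ = ∑ τ : Fin n → Bool, (f (Fin.cons true τ) + f (Fin.cons false τ)) := by
  rw [← (Fin.consEquiv fun _ : Fin (n + 1) => Bool).sum_comp, Fintype.sum_prod_type,
    Fintype.sum_bool, ← Finset.sum_add_distrib]
  rfl

theorem signSum_cons {n : ℕ} (x : Fin (n + 1) → ℝ) (b : Bool) (τ : Fin n → Bool) :
    signSum x (Fin.cons b τ) = x 0 * sgn b + signSum (fun i => x i.succ) τ := by
  simp [signSum, Fin.sum_univ_succ]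

theorem sum_signSum_sq {n : ℕ} (x : Fin n → ℝ) :
    ∑ σ, signSum x σ ^ 2 = 2 ^ n * ∑ i, x i ^ 2 := by
  induction n with
  | zero => simp [signSum]
  | succ n ih =>
    have h : ∀ τ : Fin n → Bool, signSum x (Fin.cons true τ) ^ 2 +
        signSum x (Fin.cons false τ) ^ 2 =
        2 * x 0 ^ 2 + 2 * signSum (fun i => x i.succ) τ ^ 2 := fun τ => by
      simp only [signSum_cons, sgn]
      simp
      ring
    rw [sum_signs_succ]
    simp_rw [h]
    simp only [Finset.sum_add_distrib, ← Finset.mul_sum, ih, Fin.sum_univ_succ]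
    simp
    ring

/-- Averaging over the first sign removes the odd powers, and `x₀⁴ + 6 x₀² q + 3 q² ≤ 3 (x₀² + q)²`.
-/
theorem sum_signSum_pow_four_le {n : ℕ} (x : Fin n → ℝ) :
    ∑ σ, signSum x σ ^ 4 ≤ 3 * 2 ^ n * (∑ i, x i ^ 2) ^ 2 := by
  induction n with
  | zero => simp [signSum]
  | succ n ih =>
    have h : ∀ τ : Fin n → Bool, signSum x (Fin.cons true τ) ^ 4 +
        signSum x (Fin.cons false τ) ^ 4 =
        2 * x 0 ^ 4 + 12 * x 0 ^ 2 * signSum (fun i => x i.succ) τ ^ 2 +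
          2 * signSum (fun i => x i.succ) τ ^ 4 := fun τ => by
      simp only [signSum_cons, sgn]
      simp
      ring
    rw [sum_signs_succ]
    simp_rw [h]
    simp only [Finset.sum_add_distrib, ← Finset.mul_sum, sum_signSum_sq, Fin.sum_univ_succ]
    have h2 := ih fun i => x i.succ
    set q := ∑ i : Fin n, x i.succ ^ 2
    have h3 : (0 : ℝ) ≤ 2 ^ n * x 0 ^ 4 := by positivity
    simp
    rw [pow_succ (2 : ℝ) n]
    nlinarith

/-- The product `(1 - u + u²/2) (1 + u + u²/2) = 1 + u⁴/4` is at least `1`. -/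
theorem exp_neg_le_quadratic {u : ℝ} (hu : 0 ≤ u) : Real.exp (-u) ≤ 1 - u + u ^ 2 / 2 := by
  have h := Real.quadratic_le_exp_of_nonneg hu
  rw [Real.exp_neg, inv_le_iff_one_le_mul₀ (Real.exp_pos u)]
  have h2 : 0 ≤ 1 - u + u ^ 2 / 2 := by nlinarith [sq_nonneg (u - 1)]
  have h3 := mul_le_mul_of_nonneg_left h h2
  nlinarith [sq_nonneg (u ^ 2)]

theorem sum_exp_neg_signSum_sq_le {n : ℕ} {x : Fin n → ℝ} (hx : ∑ i, x i ^ 2 = 1) {t : ℝ}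
    (ht : 0 ≤ t) :
    ∑ σ, Real.exp (-t * signSum x σ ^ 2) ≤ 2 ^ n * Real.exp (-t + 3 / 2 * t ^ 2) := by
  have h1 : ∀ σ, Real.exp (-t * signSum x σ ^ 2) ≤
      1 - t * signSum x σ ^ 2 + t ^ 2 / 2 * signSum x σ ^ 4 := fun σ => by
    have := exp_neg_le_quadratic (mul_nonneg ht (sq_nonneg (signSum x σ)))
    rw [neg_mul]
    refine this.trans_eq ?_
    ring
  refine (Finset.sum_le_sum fun σ _ => h1 σ).trans ?_
  rw [Finset.sum_add_distrib, Finset.sum_sub_distrib, ← Finset.mul_sum, ← Finset.mul_sum,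
    sum_signSum_sq, hx]
  have h4 := sum_signSum_pow_four_le x
  rw [hx] at h4
  have h5 := mul_le_mul_of_nonneg_left h4 (show 0 ≤ t ^ 2 / 2 by positivity)
  have h6 := mul_le_mul_of_nonneg_left (Real.add_one_le_exp (-t + 3 / 2 * t ^ 2))
    (show (0 : ℝ) ≤ 2 ^ n by positivity)
  simp
  nlinarith

/-- The average factors into hyperbolic cosines, each at most `exp (t² x_i² / 2)`. -/
theorem sum_exp_mul_signSum_le {n : ℕ} {x : Fin n → ℝ} (hx : ∑ i, x i ^ 2 = 1) (t : ℝ) :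
    ∑ σ, Real.exp (t * signSum x σ) ≤ 2 ^ n * Real.exp (t ^ 2 / 2) := by
  have h1 : ∀ σ, Real.exp (t * signSum x σ) = ∏ i, Real.exp (t * (x i * sgn (σ i))) := fun σ => by
    rw [signSum, Finset.mul_sum, Real.exp_sum]
  have h2 : ∑ σ : Fin n → Bool, ∏ i, Real.exp (t * (x i * sgn (σ i))) =
      ∏ i, ∑ b : Bool, Real.exp (t * (x i * sgn b)) := by
    rw [Finset.prod_univ_sum, Fintype.piFinset_univ]
  have h3 : ∀ i, ∑ b : Bool, Real.exp (t * (x i * sgn b)) ≤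
      2 * Real.exp (t ^ 2 * x i ^ 2 / 2) := fun i => by
    have := Real.cosh_le_exp_half_sq (t * x i)
    rw [Real.cosh_eq, mul_pow] at this
    simp [sgn]
    linarith
  simp_rw [h1]
  rw [h2]
  refine (Finset.prod_le_prod (fun i _ => by positivity) fun i _ => h3 i).trans_eq ?_
  rw [Finset.prod_mul_distrib, ← Real.exp_sum, ← Finset.sum_div, ← Finset.mul_sum, hx]
  simp

open MeasureTheory in
theorem integrable_exp_neg_sq_add (y : ℝ) :
    Integrable fun g : ℝ => Real.exp (-g ^ 2 + g * y) := by
  have := ((integrable_exp_neg_mul_sq one_pos).comp_sub_right (y / 2)).const_mul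
    (Real.exp (y ^ 2 / 4))
  refine this.congr (Filter.Eventually.of_forall fun g => ?_)
  simp only [← Real.exp_add]
  ring_nf

open MeasureTheory in
theorem integral_exp_neg_sq_add (y : ℝ) :
    ∫ g : ℝ, Real.exp (-g ^ 2 + g * y) = √Real.pi * Real.exp (y ^ 2 / 4) := by
  have h := integral_gaussian 1
  rw [div_one, ← integral_sub_right_eq_self _ (y / 2)] at h
  rw [← h, ← integral_mul_const]
  refine integral_congr_ae (Filter.Eventually.of_forall fun g => ?_)
  simp only [← Real.exp_add]
  ring_nf

-- Gaussian linearization: `√π exp (S²/4) = ∫ exp (-g² + g S)` turns the square into a linear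
-- exponent. Averaging over signs under the integral leaves at most `∫ exp (-g²/2) = √(2π)`.
open MeasureTheory in
theorem sum_exp_signSum_sq_le {n : ℕ} {x : Fin n → ℝ} (hx : ∑ i, x i ^ 2 = 1) :
    ∑ σ, Real.exp (1 / 4 * signSum x σ ^ 2) ≤ 2 ^ n * √2 := by
  have hpi : 0 < √Real.pi := Real.sqrt_pos.2 Real.pi_pos
  refine le_of_mul_le_mul_left ?_ hpi
  have h1 : √Real.pi * ∑ σ, Real.exp (1 / 4 * signSum x σ ^ 2) =
      ∫ g : ℝ, ∑ σ, Real.exp (-g ^ 2 + g * signSum x σ) := by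
    rw [integral_finsetSum _ fun σ _ => integrable_exp_neg_sq_add _, Finset.mul_sum]
    refine Finset.sum_congr rfl fun σ _ => ?_
    rw [integral_exp_neg_sq_add]
    ring_nf
  have h2 : ∫ g : ℝ, 2 ^ n * Real.exp (-(1 / 2) * g ^ 2) = √Real.pi * (2 ^ n * √2) := by
    rw [integral_const_mul, integral_gaussian, div_div_eq_mul_div, div_one,
      Real.sqrt_mul Real.pi_pos.le]
    ring
  rw [h1, ← h2]
  refine integral_mono (integrable_finsetSum _ fun σ _ => integrable_exp_neg_sq_add _)
    ((integrable_exp_neg_mul_sq (by norm_num)).const_mul _) fun g => ?_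
  have h3 := mul_le_mul_of_nonneg_left (sum_exp_mul_signSum_le hx g) (Real.exp_pos (-g ^ 2)).le
  simp only [Real.exp_add, ← Finset.mul_sum]
  refine h3.trans_eq ?_
  rw [mul_left_comm, ← Real.exp_add]
  ring_nf

/-- By convexity, an exponential moment bound for Rademacher sums extends to the squared norm of
the image of a sign vector under a matrix of Frobenius norm `1`. -/
theorem sum_exp_rows_le {n p : ℕ} {c β : ℝ}
    (h : ∀ x : Fin n → ℝ, ∑ i, x i ^ 2 = 1 → ∑ σ, Real.exp (c * signSum x σ ^ 2) ≤ β)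
    {X : Matrix (Fin p) (Fin n) ℝ} (hX : ∑ r, ∑ i, X r i ^ 2 = 1) :
    ∑ σ, Real.exp (c * ∑ r, signSum (X r) σ ^ 2) ≤ β := by
  set q : Fin p → ℝ := fun r => ∑ i, X r i ^ 2 with hq
  have hq0 : ∀ r, 0 ≤ q r := fun r => by positivity
  set xh : Fin p → Fin n → ℝ := fun r i => (√(q r))⁻¹ * X r i with hxh
  have hs : ∀ r σ, signSum (xh r) σ ^ 2 = (q r)⁻¹ * signSum (X r) σ ^ 2 := fun r σ => by
    have : signSum (xh r) σ = (√(q r))⁻¹ * signSum (X r) σ := by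
      simp only [signSum, hxh, Finset.mul_sum, mul_assoc]
    rw [this, mul_pow, inv_pow, Real.sq_sqrt (hq0 r)]
  have hs2 : ∀ r σ, signSum (X r) σ ^ 2 = q r * signSum (xh r) σ ^ 2 := fun r σ => by
    rcases eq_or_ne (q r) 0 with h0 | h0
    · have hz : ∀ i, X r i = 0 := fun i => by
        have := (Finset.sum_eq_zero_iff_of_nonneg (fun i _ => sq_nonneg (X r i))).1 h0 i (by simp)
        simpa using this
      simp [signSum, hz, h0]
    · rw [hs, mul_inv_cancel_left₀ h0]
  -- Jensen's inequality with the squared row norms `q r` as weights, which sum to `1`; `xh r` is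
  -- the normalized row.
  have hJ : ∀ σ, Real.exp (c * ∑ r, signSum (X r) σ ^ 2) ≤
      ∑ r, q r * Real.exp (c * signSum (xh r) σ ^ 2) := fun σ => by
    have := convexOn_exp.map_sum_le (t := Finset.univ) (w := q)
      (p := fun r => c * signSum (xh r) σ ^ 2) (fun r _ => hq0 r) hX (fun _ _ => Set.mem_univ _)
    simp only [smul_eq_mul] at this
    refine le_of_eq_of_le ?_ this
    rw [Finset.mul_sum]
    congr 1
    refine Finset.sum_congr rfl fun r _ => ?_
    rw [hs2]
    ring
  refine (Finset.sum_le_sum fun σ _ => hJ σ).trans ?_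
  rw [Finset.sum_comm]
  calc ∑ r, ∑ σ, q r * Real.exp (c * signSum (xh r) σ ^ 2) ≤ ∑ r, q r * β := by
        refine Finset.sum_le_sum fun r _ => ?_
        rw [← Finset.mul_sum]
        rcases eq_or_ne (q r) 0 with h0 | h0
        · simp [h0]
        · refine mul_le_mul_of_nonneg_left (h _ ?_) (hq0 r)
          simp only [hxh, mul_pow, ← Finset.mul_sum, inv_pow, Real.sq_sqrt (hq0 r)]
          exact inv_mul_cancel₀ h0
    _ = β := by rw [← Finset.sum_mul, hX, one_mul]

/-- The exponential Markov inequality in counting form. -/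
theorem card_filter_mul_exp_le {Ω : Type*} [Fintype Ω] (g : Ω → ℝ) (c : ℝ)
    [DecidablePred fun ω => c ≤ g ω] :
    ((Finset.univ.filter fun ω => c ≤ g ω).card : ℝ) ≤
      Real.exp (-c) * ∑ ω, Real.exp (g ω) := by
  rw [Finset.mul_sum, Finset.card_eq_sum_ones, Nat.cast_sum, Finset.sum_filter]
  refine Finset.sum_le_sum fun ω _ => ?_
  split_ifs with h
  · rw [← Real.exp_add, Nat.cast_one]
    exact Real.one_le_exp (by linarith)
  · positivity

/-- The product formula for exponential moments of independent columns. -/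
theorem sum_exp_columns {n K : ℕ} (f : (Fin n → Bool) → ℝ) :
    ∑ σ : Fin n → Fin K → Bool, Real.exp (∑ k, f fun i => σ i k) =
      (∑ τ, Real.exp (f τ)) ^ K := by
  rw [← (Equiv.piComm fun (_ : Fin K) (_ : Fin n) => Bool).sum_comp]
  simp only [Equiv.piComm_apply, Function.swap, Real.exp_sum]
  have := Finset.prod_univ_sum (fun _ : Fin K => (Finset.univ : Finset (Fin n → Bool)))
    (fun _ τ => Real.exp (f τ))
  rw [Fintype.piFinset_univ] at this
  rw [← this]
  simp

/-! ### Rademacher matrices acting on a fixed matrix -/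

/-- The rescaled Rademacher matrix built on an array of signs. -/
noncomputable def rademacherMatrix {n K : ℕ} (σ : Fin n → Fin K → Bool) : Matrix (Fin n) (Fin K) ℝ :=
  Matrix.of fun i j => (√(K : ℝ))⁻¹ * sgn (σ i j)

theorem frobNorm_rademacherMatrix_sq {n K : ℕ} (hK : 0 < K) (σ : Fin n → Fin K → Bool) :
    frobNorm (rademacherMatrix σ) ^ 2 = n := by
  have hK' : (K : ℝ) ≠ 0 := by positivity
  rw [frobNorm_sq]
  simp [rademacherMatrix, mul_pow, sgn_sq, hK']

theorem frobNorm_mul_rademacherMatrix_sq {n K p : ℕ} (X : Matrix (Fin p) (Fin n) ℝ)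
    (σ : Fin n → Fin K → Bool) :
    frobNorm (X * rademacherMatrix σ) ^ 2 =
      (K : ℝ)⁻¹ * ∑ k, ∑ r, signSum (X r) (fun i => σ i k) ^ 2 := by
  rw [frobNorm_sq, Finset.sum_comm]
  simp only [Finset.mul_sum]
  refine Finset.sum_congr rfl fun k _ => Finset.sum_congr rfl fun r _ => ?_
  have : (X * rademacherMatrix σ) r k = (√(K : ℝ))⁻¹ * signSum (X r) fun i => σ i k := by
    simp only [Matrix.mul_apply, rademacherMatrix, Matrix.of_apply, signSum, Finset.mul_sum]
    exact Finset.sum_congr rfl fun i _ => by ring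
  rw [this, mul_pow, inv_pow, Real.sq_sqrt (Nat.cast_nonneg K)]

open Classical in
theorem card_rademacher_bad_le {n K p : ℕ} (hK : 0 < K) {ε : ℝ} (h0 : 0 < ε) (h1 : ε ≤ 1)
    {X : Matrix (Fin p) (Fin n) ℝ} (hX : frobNorm X ^ 2 = 1) :
    ((Finset.univ.filter fun σ : Fin n → Fin K → Bool =>
      ¬ (1 - ε ≤ frobNorm (X * rademacherMatrix σ) ^ 2 ∧
        frobNorm (X * rademacherMatrix σ) ^ 2 ≤ 9)).card : ℝ) ≤
      2 * Real.exp (-(K * ε ^ 2 / 6)) * Fintype.card (Fin n → Fin K → Bool) := by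
  rw [frobNorm_sq] at hX
  have hK' : (0 : ℝ) < K := by exact_mod_cast hK
  set Z : (Fin n → Bool) → ℝ := fun τ => ∑ r, signSum (X r) τ ^ 2 with hZ
  have hcard : (Fintype.card (Fin n → Fin K → Bool) : ℝ) = (2 ^ n) ^ K := by
    simp [← pow_mul, mul_comm]
  -- The parameter `t = ε / 3` minimizes the exponent `-t ε + 3 t² / 2` per column, with minimum
  -- `-ε² / 6`.
  have hlow : ((Finset.univ.filter fun σ : Fin n → Fin K → Bool =>
      -(ε / 3) * ((1 - ε) * K) ≤ ∑ k, -(ε / 3) * Z fun i => σ i k).card : ℝ) ≤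
      Real.exp (-(K * ε ^ 2 / 6)) * (2 ^ n) ^ K := by
    refine (card_filter_mul_exp_le _ _).trans ?_
    rw [sum_exp_columns fun τ => -(ε / 3) * Z τ]
    have := sum_exp_rows_le (fun x hx => sum_exp_neg_signSum_sq_le hx
      (show 0 ≤ ε / 3 by positivity)) hX
    refine (mul_le_mul_of_nonneg_left (pow_le_pow_left₀ (by positivity) this K)
      (Real.exp_pos _).le).trans_eq ?_
    rw [mul_pow, ← Real.exp_nat_mul, mul_left_comm, ← Real.exp_add, mul_comm]
    ring_nf
  -- The threshold `9` leaves ample room: each column contributes at most `√2 exp (-9/4)`, below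
  -- `exp (-ε² / 6)`.
  have hup : ((Finset.univ.filter fun σ : Fin n → Fin K → Bool =>
      1 / 4 * (9 * K) ≤ ∑ k, 1 / 4 * Z fun i => σ i k).card : ℝ) ≤
      Real.exp (-(K * ε ^ 2 / 6)) * (2 ^ n) ^ K := by
    refine (card_filter_mul_exp_le _ _).trans ?_
    rw [sum_exp_columns fun τ => 1 / 4 * Z τ]
    have := sum_exp_rows_le (fun x hx => sum_exp_signSum_sq_le hx) hX
    refine (mul_le_mul_of_nonneg_left (pow_le_pow_left₀ (by positivity) this K)
      (Real.exp_pos _).le).trans ?_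
    have h2 : √2 ≤ Real.exp 1 := by
      refine Real.sqrt_le_iff.2 ⟨(Real.exp_pos _).le, ?_⟩
      nlinarith [Real.add_one_le_exp (1 : ℝ)]
    have h3 : √2 ^ K ≤ Real.exp K := by
      refine (pow_le_pow_left₀ (Real.sqrt_nonneg _) h2 K).trans_eq ?_
      rw [← Real.exp_nat_mul, mul_one]
    rw [mul_pow, mul_left_comm, mul_comm]
    refine mul_le_mul_of_nonneg_right ?_ (by positivity)
    refine (mul_le_mul_of_nonneg_left h3 (Real.exp_pos _).le).trans ?_
    rw [← Real.exp_add]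
    refine Real.exp_le_exp.2 ?_
    have : (K : ℝ) * ε ^ 2 ≤ K * 1 := by gcongr; nlinarith
    linarith
  have hsub : (Finset.univ.filter fun σ : Fin n → Fin K → Bool =>
      ¬ (1 - ε ≤ frobNorm (X * rademacherMatrix σ) ^ 2 ∧
        frobNorm (X * rademacherMatrix σ) ^ 2 ≤ 9)) ⊆
      (Finset.univ.filter fun σ : Fin n → Fin K → Bool =>
        -(ε / 3) * ((1 - ε) * K) ≤ ∑ k, -(ε / 3) * Z fun i => σ i k) ∪
      (Finset.univ.filter fun σ : Fin n → Fin K → Bool =>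
        1 / 4 * (9 * K) ≤ ∑ k, 1 / 4 * Z fun i => σ i k) := by
    intro σ hσ
    simp only [Finset.mem_filter, Finset.mem_univ, true_and, Finset.mem_union,
      ← Finset.mul_sum] at hσ ⊢
    rw [frobNorm_mul_rademacherMatrix_sq, ← div_eq_inv_mul, le_div_iff₀ hK', div_le_iff₀ hK',
      not_and_or, not_le, not_le] at hσ
    rcases hσ with h | h
    · left
      exact mul_le_mul_of_nonpos_left h.le (by linarith)
    · right
      exact mul_le_mul_of_nonneg_left h.le (by norm_num)
  have hle : ((Finset.univ.filter fun σ : Fin n → Fin K → Bool =>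
      ¬ (1 - ε ≤ frobNorm (X * rademacherMatrix σ) ^ 2 ∧
        frobNorm (X * rademacherMatrix σ) ^ 2 ≤ 9)).card : ℝ) ≤ _ :=
    Nat.cast_le.2 ((Finset.card_le_card hsub).trans (Finset.card_union_le _ _))
  refine hle.trans ?_
  rw [Nat.cast_add, hcard]
  linarith


/-! ### Sampling without replacement -/

theorem sum_notMem_range {s K : ℕ} (ρ : Fin K ↪ Fin s) (a : Fin s → ℝ) :
    ∑ j : {j // j ∉ Set.range ρ}, a j = ∑ j, a j - ∑ k, a (ρ k) := by
  classical
  have h1 := Fintype.sum_subtype_add_sum_subtype (fun j => j ∈ Set.range ρ) a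
  have h2 : ∑ k, a (ρ k) = ∑ j : {j // j ∈ Set.range ρ}, a j :=
    (Equiv.ofInjective ρ ρ.injective).sum_comp fun j : Set.range ρ => a j
  rw [h2, eq_sub_iff_add_eq', ← h1]
  congr!

/-- Index `0` plays the role of the last draw: it ranges over the elements missed by the other `K`.
-/
theorem sum_embedding_succ {s K : ℕ} (f : (Fin K → Fin s) → Fin s → ℝ) :
    ∑ ρ : Fin (K + 1) ↪ Fin s, f (ρ ∘ Fin.succ) (ρ 0) =
      ∑ ρ : Fin K ↪ Fin s, ∑ j : {j // j ∉ Set.range ρ}, f ρ j := by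
  classical
  rw [← Fintype.sum_sigma', ← (Equiv.embeddingFinSucc K (Fin s)).sum_comp]
  rfl

/-- Exchanging the draws `0` and `k.succ` preserves the sum, so the difference of the two sides is
half a sum of terms `Q (a (ρ k.succ) - a (ρ 0))²`. -/
theorem sum_embedding_prod_succ_le {s K : ℕ} {a : Fin s → ℝ} (ha : ∀ j, 0 ≤ a j) (k : Fin K) :
    ∑ ρ : Fin (K + 1) ↪ Fin s, (∏ i : Fin K, a (ρ i.succ)) * a (ρ 0) ≤
      ∑ ρ : Fin (K + 1) ↪ Fin s, (∏ i : Fin K, a (ρ i.succ)) * a (ρ k.succ) := by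
  classical
  let Q : (Fin (K + 1) ↪ Fin s) → ℝ := fun ρ => ∏ i ∈ Finset.univ.erase k, a (ρ i.succ)
  have hQ0 : ∀ ρ, 0 ≤ Q ρ := fun ρ => Finset.prod_nonneg fun i _ => ha _
  have hQ : ∀ ρ : Fin (K + 1) ↪ Fin s, ∏ i : Fin K, a (ρ i.succ) = Q ρ * a (ρ k.succ) :=
    fun ρ => (Finset.prod_erase_mul _ _ (Finset.mem_univ k)).symm
  let e : (Fin (K + 1) ↪ Fin s) ≃ (Fin (K + 1) ↪ Fin s) :=
    Equiv.embeddingCongr (Equiv.swap 0 k.succ) (Equiv.refl _)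
  have he : ∀ ρ i, e ρ i = ρ (Equiv.swap 0 k.succ i) := fun ρ i => by
    simp [e, Equiv.embeddingCongr]
  have hQe : ∀ ρ, Q (e ρ) = Q ρ := fun ρ => by
    refine Finset.prod_congr rfl fun i hi => ?_
    rw [he, Equiv.swap_apply_of_ne_of_ne (Fin.succ_ne_zero i)]
    intro h
    exact (Finset.mem_erase.1 hi).1 (Fin.succ_injective _ h)
  have hsq : ∑ ρ, Q ρ * a (ρ k.succ) ^ 2 = ∑ ρ, Q ρ * a (ρ 0) ^ 2 := by
    rw [← e.sum_comp]
    refine Finset.sum_congr rfl fun ρ _ => ?_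
    rw [hQe, he, Equiv.swap_apply_right]
  have hnn : 0 ≤ ∑ ρ, Q ρ * (a (ρ k.succ) - a (ρ 0)) ^ 2 :=
    Finset.sum_nonneg fun ρ _ => mul_nonneg (hQ0 ρ) (sq_nonneg _)
  have hexp : ∑ ρ, Q ρ * (a (ρ k.succ) - a (ρ 0)) ^ 2 =
      ∑ ρ, Q ρ * a (ρ k.succ) ^ 2 + ∑ ρ, Q ρ * a (ρ 0) ^ 2 -
        2 * ∑ ρ, Q ρ * a (ρ k.succ) * a (ρ 0) := by
    rw [Finset.mul_sum, ← Finset.sum_add_distrib, ← Finset.sum_sub_distrib]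
    exact Finset.sum_congr rfl fun ρ _ => by ring
  have hgoal : ∑ ρ, Q ρ * a (ρ k.succ) * a (ρ k.succ) = ∑ ρ, Q ρ * a (ρ k.succ) ^ 2 :=
    Finset.sum_congr rfl fun ρ _ => by ring
  simp_rw [hQ]
  linarith

/-- Maclaurin's inequality, in terms of sampling without replacement: products of samples
without replacement have a smaller expectation than products of independent samples. -/
theorem sum_embedding_prod_le {s K : ℕ} (hK : K ≤ s) {a : Fin s → ℝ} (ha : ∀ j, 0 ≤ a j) :
    s ^ K * ∑ ρ : Fin K ↪ Fin s, ∏ k, a (ρ k) ≤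
      (∑ j, a j) ^ K * Fintype.card (Fin K ↪ Fin s) := by
  induction K with
  | zero => simp
  | succ K ih =>
    specialize ih (by omega)
    set S := ∑ j, a j
    have hS : 0 ≤ S := Finset.sum_nonneg fun j _ => ha j
    set E := ∑ ρ : Fin K ↪ Fin s, ∏ k, a (ρ k) with hE
    set E' := ∑ ρ : Fin (K + 1) ↪ Fin s, ∏ k, a (ρ k) with hE'
    have hsK : (0 : ℝ) ≤ s - K := by
      rw [sub_nonneg]
      exact_mod_cast (Nat.le_succ K).trans hK
    have hcard : (Fintype.card (Fin (K + 1) ↪ Fin s) : ℝ) =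
        (s - K) * Fintype.card (Fin K ↪ Fin s) := by
      rw [Fintype.card_embedding_eq, Fintype.card_embedding_eq]
      simp only [Fintype.card_fin, Nat.descFactorial_succ]
      rw [Nat.cast_mul, Nat.cast_sub (by omega)]
    have hE1 : E' = ∑ ρ : Fin (K + 1) ↪ Fin s, (∏ i : Fin K, a (ρ i.succ)) * a (ρ 0) := by
      refine Finset.sum_congr rfl fun ρ _ => ?_
      rw [Fin.prod_univ_succ, mul_comm]
    have hE2 : E' = S * E - ∑ k, ∑ ρ : Fin K ↪ Fin s, (∏ i, a (ρ i)) * a (ρ k) := by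
      have := sum_embedding_succ (s := s) (K := K) fun ρ j => (∏ i, a (ρ i)) * a j
      simp only [Function.comp_apply] at this
      rw [hE1, this, Finset.sum_comm, hE, Finset.mul_sum, ← Finset.sum_sub_distrib]
      refine Finset.sum_congr rfl fun ρ _ => ?_
      rw [← Finset.mul_sum, ← Finset.mul_sum, sum_notMem_range ρ a]
      ring
    have hE3 : ∀ k, E' ≤ (s - K) * ∑ ρ : Fin K ↪ Fin s, (∏ i, a (ρ i)) * a (ρ k) := fun k => by
      have := sum_embedding_succ (s := s) (K := K) fun ρ _ => (∏ i, a (ρ i)) * a (ρ k)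
      simp only [Function.comp_apply] at this
      rw [hE1]
      refine (sum_embedding_prod_succ_le ha k).trans_eq ?_
      rw [this, Finset.mul_sum]
      refine Finset.sum_congr rfl fun ρ _ => ?_
      have := sum_notMem_range ρ fun _ => (∏ i, a (ρ i)) * a (ρ k)
      rw [this]
      simp
      ring
    -- Summing the exchange inequality over `k` bounds the repeated-index terms from below. By `hE2`
    -- these equal `S * E - E'`, which yields the recursion `s E' ≤ (s - K) S E`.
    have hE4 : K * E' ≤ (s - K) * ∑ k, ∑ ρ : Fin K ↪ Fin s, (∏ i, a (ρ i)) * a (ρ k) := by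
      have := Finset.sum_le_sum fun k (_ : k ∈ (Finset.univ : Finset (Fin K))) => hE3 k
      rw [← Finset.mul_sum] at this
      simpa using this
    have hE5 : s * E' ≤ (s - K) * S * E := by
      have : ∑ k, ∑ ρ : Fin K ↪ Fin s, (∏ i, a (ρ i)) * a (ρ k) = S * E - E' := by linarith
      rw [this] at hE4
      linarith
    calc (s : ℝ) ^ (K + 1) * E' = s ^ K * (s * E') := by ring
      _ ≤ s ^ K * ((s - K) * S * E) := by gcongr
      _ = (s - K) * S * (s ^ K * E) := by ring
      _ ≤ (s - K) * S * (S ^ K * Fintype.card (Fin K ↪ Fin s)) := by gcongr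
      _ = S ^ (K + 1) * Fintype.card (Fin (K + 1) ↪ Fin s) := by
        rw [hcard]
        ring

theorem card_sampling_exp_le {s K : ℕ} (hs : 0 < s) (hK : K ≤ s) {Z : Fin s → ℝ} {c b : ℝ}
    (h : ∑ j, Real.exp (c * Z j) ≤ s * Real.exp b) :
    ∑ ρ : Fin K ↪ Fin s, Real.exp (∑ k, c * Z (ρ k)) ≤
      Real.exp (K * b) * Fintype.card (Fin K ↪ Fin s) := by
  have hs' : (0 : ℝ) < s ^ K := by positivity
  have h1 := sum_embedding_prod_le hK fun j => (Real.exp_pos (c * Z j)).le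
  refine le_of_mul_le_mul_left ?_ hs'
  simp only [Real.exp_sum]
  refine h1.trans ?_
  rw [Real.exp_nat_mul, ← mul_assoc, ← mul_pow]
  gcongr

open Classical in
/-- A tail bound for sampling without replacement. -/
theorem card_sampling_bad_le {s K : ℕ} (hs : 0 < s) (hK : K ≤ s) {Z : Fin s → ℝ} {μ : ℝ}
    (hμ : 0 < μ) (hZ0 : ∀ j, 0 ≤ Z j) (hZμ : ∀ j, Z j ≤ μ) (hZ : ∑ j, Z j = s) {ε : ℝ}
    (h0 : 0 < ε) (h1 : ε ≤ 1) :
    ((Finset.univ.filter fun ρ : Fin K ↪ Fin s =>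
      ¬ ((1 - ε) * K ≤ ∑ k, Z (ρ k) ∧ ∑ k, Z (ρ k) ≤ 9 * K)).card : ℝ) ≤
      2 * Real.exp (-(K * ε ^ 2 / (2 * μ))) * Fintype.card (Fin K ↪ Fin s) := by
  have hs' : (0 : ℝ) < s := by exact_mod_cast hs
  -- Since `Z² ≤ μ Z`, the quadratic bound on `exp (-t Z)` becomes linear in `Z`, whose mean is `1`;
  -- `t = ε / μ` is the optimal parameter.
  have hlow : ((Finset.univ.filter fun ρ : Fin K ↪ Fin s =>
      -(ε / μ) * ((1 - ε) * K) ≤ ∑ k, -(ε / μ) * Z (ρ k)).card : ℝ) ≤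
      Real.exp (-(K * ε ^ 2 / (2 * μ))) * Fintype.card (Fin K ↪ Fin s) := by
    refine (card_filter_mul_exp_le _ _).trans ?_
    have hb : ∑ j, Real.exp (-(ε / μ) * Z j) ≤ s * Real.exp (-(ε / μ) + ε ^ 2 / (2 * μ)) := by
      have hj : ∀ j, Real.exp (-(ε / μ) * Z j) ≤
          1 + (-(ε / μ) + ε ^ 2 / (2 * μ)) * Z j := fun j => by
        have := exp_neg_le_quadratic (mul_nonneg (div_pos h0 hμ).le (hZ0 j))
        rw [neg_mul]
        refine this.trans ?_
        have h2 : (ε / μ * Z j) ^ 2 / 2 ≤ ε ^ 2 / (2 * μ) * Z j := by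
          have : (ε / μ * Z j) ^ 2 / 2 = ε ^ 2 / (2 * μ ^ 2) * (Z j * Z j) := by
            field_simp
          rw [this]
          have h3 : ε ^ 2 / (2 * μ) * Z j = ε ^ 2 / (2 * μ ^ 2) * (μ * Z j) := by
            field_simp
          rw [h3]
          have := mul_le_mul_of_nonneg_right (hZμ j) (hZ0 j)
          gcongr
        linarith
      refine (Finset.sum_le_sum fun j _ => hj j).trans ?_
      rw [Finset.sum_add_distrib, ← Finset.mul_sum, hZ]
      have := mul_le_mul_of_nonneg_left
        (Real.add_one_le_exp (-(ε / μ) + ε ^ 2 / (2 * μ))) hs'.le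
      simp
      linarith
    refine (mul_le_mul_of_nonneg_left (card_sampling_exp_le hs hK hb)
      (Real.exp_pos _).le).trans_eq ?_
    rw [← mul_assoc, ← Real.exp_add]
    congr 2
    field_simp
    ring
  have hup : ((Finset.univ.filter fun ρ : Fin K ↪ Fin s =>
      1 / μ * (9 * K) ≤ ∑ k, 1 / μ * Z (ρ k)).card : ℝ) ≤
      Real.exp (-(K * ε ^ 2 / (2 * μ))) * Fintype.card (Fin K ↪ Fin s) := by
    refine (card_filter_mul_exp_le _ _).trans ?_
    -- On `[0, 1]` one has `exp u ≤ 1 + 2u`; with threshold `9` the exponent per draw is `-7 / μ`.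
    have hb : ∑ j, Real.exp (1 / μ * Z j) ≤ s * Real.exp (2 / μ) := by
      have hj : ∀ j, Real.exp (1 / μ * Z j) ≤ 1 + 2 / μ * Z j := fun j => by
        have hu0 : 0 ≤ 1 / μ * Z j := mul_nonneg (by positivity) (hZ0 j)
        have hu1 : 1 / μ * Z j ≤ 1 := by
          rw [one_div, ← div_eq_inv_mul, div_le_one hμ]
          exact hZμ j
        have h2 := abs_le.1 (Real.abs_exp_sub_one_sub_id_le (abs_le.2 ⟨by linarith, hu1⟩))
        have h3 : 2 / μ * Z j = 2 * (1 / μ * Z j) := by ring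
        rw [h3]
        nlinarith [h2.2]
      refine (Finset.sum_le_sum fun j _ => hj j).trans ?_
      rw [Finset.sum_add_distrib, ← Finset.mul_sum, hZ]
      have := mul_le_mul_of_nonneg_left (Real.add_one_le_exp (2 / μ)) hs'.le
      simp
      linarith
    refine (mul_le_mul_of_nonneg_left (card_sampling_exp_le hs hK hb)
      (Real.exp_pos _).le).trans ?_
    rw [← mul_assoc, ← Real.exp_add]
    gcongr
    have e1 : -(1 / μ * (9 * K)) + K * (2 / μ) = -(K * 14 / (2 * μ)) := by
      field_simp
      ring
    rw [e1]
    gcongr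
    nlinarith
  have hsub : (Finset.univ.filter fun ρ : Fin K ↪ Fin s =>
      ¬ ((1 - ε) * K ≤ ∑ k, Z (ρ k) ∧ ∑ k, Z (ρ k) ≤ 9 * K)) ⊆
      (Finset.univ.filter fun ρ : Fin K ↪ Fin s =>
        -(ε / μ) * ((1 - ε) * K) ≤ ∑ k, -(ε / μ) * Z (ρ k)) ∪
      (Finset.univ.filter fun ρ : Fin K ↪ Fin s =>
        1 / μ * (9 * K) ≤ ∑ k, 1 / μ * Z (ρ k)) := by
    intro ρ hρ
    simp only [Finset.mem_filter, Finset.mem_univ, true_and, Finset.mem_union,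
      ← Finset.mul_sum] at hρ ⊢
    rw [not_and_or, not_le, not_le] at hρ
    have hεμ : 0 < ε / μ := div_pos h0 hμ
    rcases hρ with h | h
    · left
      exact mul_le_mul_of_nonpos_left h.le (by linarith)
    · right
      exact mul_le_mul_of_nonneg_left h.le (by positivity)
  have hle : ((Finset.univ.filter fun ρ : Fin K ↪ Fin s =>
      ¬ ((1 - ε) * K ≤ ∑ k, Z (ρ k) ∧ ∑ k, Z (ρ k) ≤ 9 * K)).card : ℝ) ≤ _ :=
    Nat.cast_le.2 ((Finset.card_le_card hsub).trans (Finset.card_union_le _ _))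
  refine hle.trans ?_
  rw [Nat.cast_add]
  linarith


/-! ### The P-SRHT -/

/-- The P-SRHT matrix built on the signs `ω.1` and the row selection `ω.2`. -/
noncomputable def psrhtMatrix {n K : ℕ}
    (H : Matrix (Fin (srhtOrder n)) (Fin (srhtOrder n)) ℝ)
    (ω : (Fin (srhtOrder n) → Bool) × (Fin K ↪ Fin (srhtOrder n))) : Matrix (Fin n) (Fin K) ℝ :=
  ((√(K : ℝ))⁻¹ • (rowSelection ω.2 * H *
    Matrix.diagonal (fun i => sgn (ω.1 i))).transpose).submatrix (Fin.castLE (le_srhtOrder n)) id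

theorem psrhtMatrix_apply {n K : ℕ}
    (H : Matrix (Fin (srhtOrder n)) (Fin (srhtOrder n)) ℝ)
    (ω : (Fin (srhtOrder n) → Bool) × (Fin K ↪ Fin (srhtOrder n))) (i : Fin n) (k : Fin K) :
    psrhtMatrix H ω i k = (√(K : ℝ))⁻¹ *
      (H (ω.2 k) (Fin.castLE (le_srhtOrder n) i) * sgn (ω.1 (Fin.castLE (le_srhtOrder n) i))) := by
  simp [psrhtMatrix, rowSelection, Matrix.mul_apply, Matrix.one_apply, Matrix.diagonal_apply,
    mul_comm (sgn _)]

theorem sq_apply_of_isHadamard {s : ℕ} {H : Matrix (Fin s) (Fin s) ℝ} (hH : H.IsHadamard)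
    (i j : Fin s) : H i j ^ 2 = 1 := by
  have := (Unitary.mem_iff.1 (hH.apply_mem i j)).1
  rw [star_trivial] at this
  rw [sq, this]

theorem frobNorm_psrhtMatrix_sq {n K : ℕ} (hK : 0 < K)
    {H : Matrix (Fin (srhtOrder n)) (Fin (srhtOrder n)) ℝ} (hH : H.IsHadamard)
    (ω : (Fin (srhtOrder n) → Bool) × (Fin K ↪ Fin (srhtOrder n))) :
    frobNorm (psrhtMatrix H ω) ^ 2 = n := by
  have hK' : (K : ℝ) ≠ 0 := by positivity
  rw [frobNorm_sq]
  simp [psrhtMatrix_apply, mul_pow, sgn_sq, sq_apply_of_isHadamard hH, hK']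

section Flattening

variable {n p : ℕ} (H : Matrix (Fin (srhtOrder n)) (Fin (srhtOrder n)) ℝ)
  (X : Matrix (Fin p) (Fin n) ℝ)

/-- The matrix `X`, padded with zero columns, with the columns multiplied by the entries of the
`j`-th row of `H`. -/
noncomputable def paddedRow (j : Fin (srhtOrder n)) : Matrix (Fin p) (Fin (srhtOrder n)) ℝ :=
  fun r i => Function.extend (Fin.castLE (le_srhtOrder n)) (X r) 0 i * H j i

/-- The squared norm of the image under `X` of the `j`-th signed row of `H`. -/
noncomputable def rowEnergy (σ : Fin (srhtOrder n) → Bool) (j : Fin (srhtOrder n)) : ℝ :=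
  ∑ r, signSum (paddedRow H X j r) σ ^ 2

theorem sum_extend_mul (r : Fin p) (g : Fin (srhtOrder n) → ℝ) :
    ∑ i, Function.extend (Fin.castLE (le_srhtOrder n)) (X r) 0 i * g i =
      ∑ i, X r i * g (Fin.castLE (le_srhtOrder n) i) := by
  have hinj := Fin.castLE_injective (le_srhtOrder n)
  symm
  refine Fintype.sum_of_injective _ hinj _ _ (fun i hi => ?_) fun i => ?_
  · rw [Function.extend_apply' _ _ _ fun ⟨a, ha⟩ => hi ⟨a, ha⟩]
    simp
  · rw [hinj.extend_apply]

theorem sum_extend_sq (r : Fin p) :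
    ∑ i, Function.extend (Fin.castLE (le_srhtOrder n)) (X r) 0 i ^ 2 = ∑ i, X r i ^ 2 := by
  simp_rw [sq]
  rw [sum_extend_mul]
  simp_rw [(Fin.castLE_injective (le_srhtOrder n)).extend_apply]

theorem frobNorm_mul_psrhtMatrix_sq {K : ℕ}
    (ω : (Fin (srhtOrder n) → Bool) × (Fin K ↪ Fin (srhtOrder n))) :
    frobNorm (X * psrhtMatrix H ω) ^ 2 = (K : ℝ)⁻¹ * ∑ k, rowEnergy H X ω.1 (ω.2 k) := by
  rw [frobNorm_sq, Finset.sum_comm]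
  simp only [rowEnergy, Finset.mul_sum]
  refine Finset.sum_congr rfl fun k _ => Finset.sum_congr rfl fun r _ => ?_
  have : (X * psrhtMatrix H ω) r k = (√(K : ℝ))⁻¹ * signSum (paddedRow H X (ω.2 k) r) ω.1 := by
    simp only [signSum, paddedRow, mul_assoc]
    rw [sum_extend_mul X r fun i => H (ω.2 k) i * sgn (ω.1 i)]
    simp only [Matrix.mul_apply, psrhtMatrix_apply, Finset.mul_sum]
    exact Finset.sum_congr rfl fun i _ => by ring
  rw [this, mul_pow, inv_pow, Real.sq_sqrt (Nat.cast_nonneg K)]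

theorem rowEnergy_nonneg (σ : Fin (srhtOrder n) → Bool) (j : Fin (srhtOrder n)) :
    0 ≤ rowEnergy H X σ j :=
  Finset.sum_nonneg fun _ _ => sq_nonneg _

variable {H X}

theorem sum_paddedRow_sq (hH : H.IsHadamard) (hX : frobNorm X ^ 2 = 1)
    (j : Fin (srhtOrder n)) : ∑ r, ∑ i, paddedRow H X j r i ^ 2 = 1 := by
  rw [← hX, frobNorm_sq]
  refine Finset.sum_congr rfl fun r _ => ?_
  simp only [paddedRow, mul_pow, sq_apply_of_isHadamard hH, mul_one]
  exact sum_extend_sq X r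

theorem sum_rowEnergy (hH : H.IsHadamard) (hX : frobNorm X ^ 2 = 1)
    (σ : Fin (srhtOrder n) → Bool) : ∑ j, rowEnergy H X σ j = srhtOrder n := by
  simp only [rowEnergy]
  rw [Finset.sum_comm]
  have hrow : ∀ r, ∑ j, signSum (paddedRow H X j r) σ ^ 2 =
      srhtOrder n * ∑ i, X r i ^ 2 := fun r => by
    set y : Fin (srhtOrder n) → ℝ :=
      fun i => Function.extend (Fin.castLE (le_srhtOrder n)) (X r) 0 i * sgn (σ i) with hy
    have h1 : ∀ j, signSum (paddedRow H X j r) σ = (H.mulVec y) j := fun j => by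
      simp only [signSum, paddedRow, Matrix.mulVec, dotProduct, hy]
      exact Finset.sum_congr rfl fun i _ => by ring
    have h2 : ∑ j, (H.mulVec y) j ^ 2 = dotProduct (H.mulVec y) (H.mulVec y) := by
      simp [dotProduct, sq]
    -- The identity `Hᵀ H = s I` makes the total energy independent of the signs.
    have h3 := hH.conjTranspose_mul
    rw [Matrix.conjTranspose_eq_transpose_of_trivial] at h3
    simp_rw [h1]
    rw [h2, Matrix.dotProduct_mulVec, ← Matrix.mulVec_transpose, Matrix.mulVec_mulVec, h3,
      Matrix.smul_mulVec, Matrix.one_mulVec, smul_dotProduct, smul_eq_mul, Fintype.card_fin,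
      ← sum_extend_sq]
    congr 1
    simp only [dotProduct, hy]
    refine Finset.sum_congr rfl fun i _ => ?_
    rw [← sq, mul_pow, sgn_sq, mul_one]
  simp_rw [hrow]
  rw [← Finset.mul_sum, ← frobNorm_sq, hX, mul_one]

-- A union bound over the `s` rows: each padded signed row is a Rademacher sum of total squared
-- weight `1`.
open Classical in
theorem card_not_flat_le (hH : H.IsHadamard) (hX : frobNorm X ^ 2 = 1) (μ : ℝ) :
    ((Finset.univ.filter fun σ => ∃ j, μ ≤ rowEnergy H X σ j).card : ℝ) ≤
      srhtOrder n * (√2 * Real.exp (-(μ / 4))) * 2 ^ srhtOrder n := by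
  have hj : ∀ j, ((Finset.univ.filter fun σ => 1 / 4 * μ ≤ 1 / 4 * rowEnergy H X σ j).card : ℝ) ≤
      √2 * Real.exp (-(μ / 4)) * 2 ^ srhtOrder n := fun j => by
    refine (card_filter_mul_exp_le _ _).trans ?_
    have := sum_exp_rows_le (fun x hx => sum_exp_signSum_sq_le hx) (sum_paddedRow_sq hH hX j)
    refine (mul_le_mul_of_nonneg_left this (Real.exp_pos _).le).trans_eq ?_
    ring_nf
  have hsub : (Finset.univ.filter fun σ => ∃ j, μ ≤ rowEnergy H X σ j) ⊆
      Finset.univ.biUnion fun j =>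
        Finset.univ.filter fun σ => 1 / 4 * μ ≤ 1 / 4 * rowEnergy H X σ j := by
    intro σ hσ
    obtain ⟨j, hj⟩ := (Finset.mem_filter.1 hσ).2
    exact Finset.mem_biUnion.2 ⟨j, Finset.mem_univ _, Finset.mem_filter.2
      ⟨Finset.mem_univ _, mul_le_mul_of_nonneg_left hj (by norm_num)⟩⟩
  have hle := Nat.cast_le (α := ℝ).2 ((Finset.card_le_card hsub).trans Finset.card_biUnion_le)
  refine hle.trans ?_
  rw [Nat.cast_sum]
  refine (Finset.sum_le_sum fun j _ => hj j).trans_eq ?_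
  simp
  ring

open Classical in
theorem card_psrht_bad_le {K : ℕ} (hn : 0 < n) (hK0 : 0 < K) (hK : K ≤ srhtOrder n)
    (hH : H.IsHadamard) (hX : frobNorm X ^ 2 = 1) {μ : ℝ} (hμ : 0 < μ) {ε : ℝ} (h0 : 0 < ε)
    (h1 : ε ≤ 1) :
    ((Finset.univ.filter fun ω : (Fin (srhtOrder n) → Bool) × (Fin K ↪ Fin (srhtOrder n)) =>
      ¬ (1 - ε ≤ frobNorm (X * psrhtMatrix H ω) ^ 2 ∧
        frobNorm (X * psrhtMatrix H ω) ^ 2 ≤ 9)).card : ℝ) ≤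
      (srhtOrder n * (√2 * Real.exp (-(μ / 4))) + 2 * Real.exp (-(K * ε ^ 2 / (2 * μ)))) *
        Fintype.card ((Fin (srhtOrder n) → Bool) × (Fin K ↪ Fin (srhtOrder n))) := by
  have hK' : (0 : ℝ) < K := by exact_mod_cast hK0
  have hs0 : 0 < srhtOrder n := hn.trans_le (le_srhtOrder n)
  set D : ℝ := (Fintype.card (Fin K ↪ Fin (srhtOrder n)) : ℝ)
  set e : ℝ := 2 * Real.exp (-(K * ε ^ 2 / (2 * μ)))
  have hD0 : 0 ≤ D := Nat.cast_nonneg _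
  have he0 : 0 ≤ e := by positivity
  let bad : (Fin (srhtOrder n) → Bool) → (Fin K ↪ Fin (srhtOrder n)) → Prop := fun σ ρ =>
    ¬ ((1 - ε) * K ≤ ∑ k, rowEnergy H X σ (ρ k) ∧ ∑ k, rowEnergy H X σ (ρ k) ≤ 9 * K)
  have hbad : ∀ ω : (Fin (srhtOrder n) → Bool) × (Fin K ↪ Fin (srhtOrder n)),
      (¬ (1 - ε ≤ frobNorm (X * psrhtMatrix H ω) ^ 2 ∧
        frobNorm (X * psrhtMatrix H ω) ^ 2 ≤ 9)) ↔ bad ω.1 ω.2 := fun ω => by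
    rw [frobNorm_mul_psrhtMatrix_sq, ← div_eq_inv_mul, le_div_iff₀ hK', div_le_iff₀ hK']
  -- Conditioning on the signs: if some row energy reaches `μ`, all selections are counted as bad;
  -- otherwise the sampling tail applies.
  have hσ : ∀ σ, ((Finset.univ.filter fun ρ => bad σ ρ).card : ℝ) ≤
      (if ∃ j, μ ≤ rowEnergy H X σ j then 1 else 0) * D + e * D := fun σ => by
    split_ifs with h
    · have : ((Finset.univ.filter fun ρ => bad σ ρ).card : ℝ) ≤ D :=
        Nat.cast_le.2 (Finset.card_le_univ _)
      have := mul_nonneg he0 hD0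
      linarith
    · push Not at h
      have := card_sampling_bad_le hs0 hK hμ (fun j => rowEnergy_nonneg H X σ j)
        (fun j => (h j).le) (sum_rowEnergy hH hX σ) h0 h1
      rw [zero_mul, zero_add]
      exact this
  have hcard : ((Finset.univ.filter fun ω : (Fin (srhtOrder n) → Bool) × (Fin K ↪ Fin (srhtOrder n)) =>
      ¬ (1 - ε ≤ frobNorm (X * psrhtMatrix H ω) ^ 2 ∧
        frobNorm (X * psrhtMatrix H ω) ^ 2 ≤ 9)).card : ℝ) =
      ∑ σ, ((Finset.univ.filter fun ρ => bad σ ρ).card : ℝ) := by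
    simp_rw [hbad, Finset.card_filter, Nat.cast_sum]
    rw [Fintype.sum_prod_type]
  rw [hcard]
  refine (Finset.sum_le_sum fun σ _ => hσ σ).trans ?_
  have hflat := card_not_flat_le hH hX μ
  rw [Finset.card_filter, Nat.cast_sum] at hflat
  push_cast at hflat
  rw [Finset.sum_add_distrib, ← Finset.sum_mul, Fintype.card_prod, Nat.cast_mul]
  have h2 := mul_le_mul_of_nonneg_right hflat hD0
  simp only [Finset.sum_const, Finset.card_univ, Fintype.card_fun, Fintype.card_bool,
    Fintype.card_fin, nsmul_eq_mul, Nat.cast_pow, Nat.cast_ofNat] at h2 ⊢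
  refine (add_le_add_left h2 _).trans_eq ?_
  ring

end Flattening

theorem srhtOrder_le {n : ℕ} (hn : 0 < n) : srhtOrder n ≤ 2 * n := by
  rcases Nat.lt_or_ge 1 n with h | h
  · have h1 := Nat.pow_pred_clog_lt_self one_lt_two h
    have h2 := Nat.clog_pos one_lt_two h
    have h3 : srhtOrder n = 2 * 2 ^ (Nat.clog 2 n).pred := by
      rw [srhtOrder, ← pow_succ', ← Nat.succ_eq_add_one, Nat.succ_pred_eq_of_pos h2]
    omega
  · have : n = 1 := by omega
    subst this
    simp [srhtOrder]

/-! ### Probability of a uniform embedding -/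

open Classical in
theorem le_uniform_map_toOuterMeasure {Ω α : Type*} [Fintype Ω] [Nonempty Ω] (f : Ω → α)
    {S : Set α} {δ : ℝ} {good : Ω → Prop}
    (hbad : ((Finset.univ.filter fun ω => ¬ good ω).card : ℝ) ≤ δ * Fintype.card Ω)
    (hgood : ∀ ω, good ω → f ω ∈ S) :
    ENNReal.ofReal (1 - δ) ≤ ((PMF.uniformOfFintype Ω).map f).toOuterMeasure S := by
  rw [PMF.toOuterMeasure_map_apply, PMF.toOuterMeasure_uniformOfFintype_apply]
  have hΩ : (0 : ℝ) < Fintype.card Ω := by exact_mod_cast Fintype.card_pos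
  have h1 : (Finset.univ.filter good).card ≤ Fintype.card (f ⁻¹' S) := by
    rw [Fintype.card_subtype]
    exact Finset.card_le_card fun ω hω => by
      simpa using hgood ω (Finset.mem_filter.1 hω).2
  have h2 : ((Finset.univ.filter good).card : ℝ) + (Finset.univ.filter fun ω => ¬ good ω).card =
      Fintype.card Ω := by
    exact_mod_cast Finset.card_filter_add_card_filter_not good
  have h3 : 1 - δ ≤ (Fintype.card (f ⁻¹' S) : ℝ) / Fintype.card Ω := by
    rw [le_div_iff₀ hΩ]
    have : ((Finset.univ.filter good).card : ℝ) ≤ Fintype.card (f ⁻¹' S) := by exact_mod_cast h1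
    linarith
  refine (ENNReal.ofReal_le_ofReal h3).trans_eq ?_
  rw [ENNReal.ofReal_div_of_pos hΩ, ENNReal.ofReal_natCast, ENNReal.ofReal_natCast]

section Embedding

attribute [local instance] Matrix.frobeniusNormedAddCommGroup Matrix.frobeniusNormedSpace

theorem norm_eq_frobNorm {n k : ℕ} (B : Matrix (Fin n) (Fin k) ℝ) : ‖B‖ = frobNorm B := by
  rw [← sq_eq_sq₀ (norm_nonneg _) (frobNorm_nonneg _), frobNorm_sq, Matrix.frobenius_norm_def,
    ← Real.sqrt_eq_rpow, Real.sq_sqrt (by positivity)]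
  simp

/-- Right multiplication by `V` on a space of matrices. -/
noncomputable def mulRightOn {n K : ℕ} (W : Submodule ℝ (Matrix (Fin n) (Fin n) ℝ))
    (V : Matrix (Fin n) (Fin K) ℝ) : W →ₗ[ℝ] Matrix (Fin n) (Fin K) ℝ where
  toFun X := X.1 * V
  map_add' X Y := by simp [Matrix.add_mul]
  map_smul' c X := by simp

open Classical in
/-- A random matrix which nearly preserves each Frobenius norm is with high probability an
embedding of each low-dimensional space of matrices. -/
theorem card_not_embedding_le {Ω : Type*} [Fintype Ω] {n K d : ℕ}
    (V : Ω → Matrix (Fin n) (Fin K) ℝ) {ε δ C : ℝ} (h0 : 0 < ε) (h1 : ε ≤ 1) (hC : 1 < C)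
    (hδ : 0 ≤ δ) (hε' : ε * (C + 1) / (C - 1) < 1)
    (hV : ∀ X : Matrix (Fin n) (Fin n) ℝ, frobNorm X ^ 2 = 1 →
      ((Finset.univ.filter fun ω => ¬ (1 - ε ≤ frobNorm (X * V ω) ^ 2 ∧
        frobNorm (X * V ω) ^ 2 ≤ 9)).card : ℝ) ≤ δ / (9 * C / ε) ^ d * Fintype.card Ω)
    (W : Submodule ℝ (Matrix (Fin n) (Fin n) ℝ)) (hW : Module.finrank ℝ W ≤ d) :
    ((Finset.univ.filter fun ω => ¬ ∀ X ∈ W, (1 - ε * (C + 1) / (C - 1)) * frobNorm X ^ 2 ≤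
      frobNorm (X * V ω) ^ 2).card : ℝ) ≤ δ * Fintype.card Ω := by
  -- This radius gives `1 + 2 / r = 1 + 8C/ε ≤ 9C/ε`, and its net error `3r / (1 - r)` is at most `ε
  -- / (C - 1)`.
  set r := ε / (4 * C) with hr
  have hC0 : 0 < C := by linarith
  have hr0 : 0 < r := by positivity
  have hr1 : r < 1 := by
    rw [hr, div_lt_one (by positivity)]
    linarith
  obtain ⟨s, hs1, hnet, hcard⟩ := exists_sphere_net (E := W) hr0
  have hN : (1 : ℝ) ≤ 9 * C / ε := by
    rw [le_div_iff₀ h0]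
    linarith
  have hcard' : (s.card : ℝ) ≤ (9 * C / ε) ^ d := by
    refine hcard.trans ((pow_le_pow_left₀ (by positivity) ?_ _).trans (pow_le_pow_right₀ hN hW))
    have : 1 + 2 / r = 1 + 8 * C / ε := by
      rw [hr]
      field_simp
      ring
    rw [this, ← sub_nonneg]
    have : 9 * C / ε - (1 + 8 * C / ε) = (C - ε) / ε := by
      field_simp
      ring
    rw [this]
    exact div_nonneg (by linarith) h0.le
  have hsub : (Finset.univ.filter fun ω => ¬ ∀ X ∈ W,
      (1 - ε * (C + 1) / (C - 1)) * frobNorm X ^ 2 ≤ frobNorm (X * V ω) ^ 2) ⊆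
      s.biUnion fun c => Finset.univ.filter fun ω =>
        ¬ (1 - ε ≤ frobNorm (c.1 * V ω) ^ 2 ∧ frobNorm (c.1 * V ω) ^ 2 ≤ 9) := by
    intro ω hω
    by_contra hbad
    have hgood : ∀ c ∈ s, 1 - ε ≤ frobNorm (c.1 * V ω) ^ 2 ∧ frobNorm (c.1 * V ω) ^ 2 ≤ 9 :=
      fun c hc => by
        by_contra h
        exact hbad (Finset.mem_biUnion.2 ⟨c, hc, Finset.mem_filter.2 ⟨Finset.mem_univ _, h⟩⟩)
    refine (Finset.mem_filter.1 hω).2 fun X hX => ?_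
    have hf : ∀ x : W, ‖mulRightOn W (V ω) x‖ = frobNorm (x.1 * V ω) :=
      fun x => norm_eq_frobNorm _
    have key := norm_lower_bound_of_net (mulRightOn W (V ω)) (a := √(1 - ε)) (b := 3) hr0.le hr1
      (by norm_num) s hnet
      (fun c hc => by
        rw [hf]
        exact Real.sqrt_le_iff.2 ⟨frobNorm_nonneg _, (hgood c hc).1⟩)
      (fun c hc => by
        rw [hf]
        refine le_of_sq_le_sq ?_ (by norm_num)
        exact (hgood c hc).2.trans_eq (by norm_num)) ⟨X, hX⟩
    rw [hf] at key
    have hnX : ‖(⟨X, hX⟩ : W)‖ = frobNorm X := norm_eq_frobNorm X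
    rw [hnX] at key
    have key2 := (mul_le_mul_of_nonneg_right (net_radius_bound h0 h1 hC hε')
      (frobNorm_nonneg X)).trans key
    have key3 := pow_le_pow_left₀
      (mul_nonneg (Real.sqrt_nonneg _) (frobNorm_nonneg X)) key2 2
    rwa [mul_pow, Real.sq_sqrt (by linarith)] at key3
  have hle := Nat.cast_le (α := ℝ).2 ((Finset.card_le_card hsub).trans Finset.card_biUnion_le)
  refine hle.trans ?_
  rw [Nat.cast_sum]
  refine (Finset.sum_le_sum fun c hc => hV c.1 ?_).trans ?_
  · rw [← norm_eq_frobNorm]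
    have := hs1 c hc
    rw [Submodule.coe_norm] at this
    rw [this, one_pow]
  · rw [Finset.sum_const, nsmul_eq_mul, ← mul_assoc]
    refine mul_le_mul_of_nonneg_right ?_ (Nat.cast_nonneg _)
    rw [mul_div_assoc', div_le_iff₀ (by positivity), mul_comm]
    gcongr

end Embedding

open Classical in
/-- The bounds hold with high probability for each random matrix of Frobenius norm `√n` which
nearly preserves each Frobenius norm with sufficiently high probability. -/
theorem le_prob_semiNormBounds {Ω : Type*} [Fintype Ω] [Nonempty Ω] {n K m : ℕ} (hn : 0 < n)
    (V : Ω → Matrix (Fin n) (Fin K) ℝ) (hVn : ∀ ω, frobNorm (V ω) ^ 2 = n)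
    {ε δ C : ℝ} (h0 : 0 < ε) (h1 : ε ≤ 1) (hC : 1 < C)
    (hδ : 0 ≤ δ) (hε' : ε * (C + 1) / (C - 1) < 1)
    (hV : ∀ X : Matrix (Fin n) (Fin n) ℝ, frobNorm X ^ 2 = 1 →
      ((Finset.univ.filter fun ω => ¬ (1 - ε ≤ frobNorm (X * V ω) ^ 2 ∧
        frobNorm (X * V ω) ^ 2 ≤ 9)).card : ℝ) ≤ δ / (9 * C / ε) ^ (m + 1) * Fintype.card Ω)
    {Y : Set (Matrix (Fin n) (Fin n) ℝ)} (hY : ∀ Q ∈ Y, ∀ t : ℝ, 0 ≤ t → t • Q ∈ Y)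
    {P : Fin m → Matrix (Fin n) (Fin n) ℝ} (hYP : Y ⊆ Submodule.span ℝ (Set.range P))
    (A : Matrix (Fin n) (Fin n) ℝ) :
    ENNReal.ofReal (1 - δ) ≤ ((PMF.uniformOfFintype Ω).map V).toOuterMeasure
      {V | ∀ P, IsSemiFrobProjection Y A V P →
        SemiNormBounds (ε * (C + 1) / (C - 1)) V (P * A)} := by
  -- The span of `b` is fixed before `V` is drawn and contains `Q * A` and `1 - Q * A` for every `Q
  -- ∈ Y`.
  let b : Fin (m + 1) → Matrix (Fin n) (Fin n) ℝ := Fin.cons 1 fun i => P i * A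
  let W := Submodule.span ℝ (Set.range b)
  have hW : Module.finrank ℝ W ≤ m + 1 := by
    have := finrank_range_le_card (R := ℝ) b
    rwa [Fintype.card_fin] at this
  have hone : (1 : Matrix (Fin n) (Fin n) ℝ) ∈ W := Submodule.subset_span ⟨0, rfl⟩
  have hmem : ∀ Q ∈ Y, Q * A ∈ W := fun Q hQ => by
    have hle : Submodule.span ℝ (Set.range P) ≤ W.comap (LinearMap.mulRight ℝ A) :=
      Submodule.span_le.2 (by
        rintro _ ⟨i, rfl⟩
        exact Submodule.subset_span ⟨i.succ, rfl⟩)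
    exact hle (hYP hQ)
  refine le_uniform_map_toOuterMeasure V
    (card_not_embedding_le V h0 h1 hC hδ hε' hV W hW) fun ω hω Q hQ => ?_
  have hQW := hmem Q hQ.1
  exact semiNormBounds_of_embedding hn hε' hY (hVn ω) hQ (hω _ hQW)
    (hω _ (W.sub_mem hone hQW))

/-! ### Failure probabilities for the prescribed numbers of columns -/

theorem rademacher_failure_le {n K : ℕ} (hn : 0 < n) {ε δ N : ℝ} (h0 : 0 < ε) (hδ : 0 < δ)
    (hN : 0 < N) (h : 6 * (ε ^ 2)⁻¹ * Real.log (2 * n * N / δ) ≤ K) :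
    2 * Real.exp (-(K * ε ^ 2 / 6)) ≤ δ / N := by
  have hn1 : (1 : ℝ) ≤ n := by exact_mod_cast hn
  have harg : 0 < 2 * n * N / δ := by positivity
  have h2 : Real.log (2 * n * N / δ) ≤ K * ε ^ 2 / 6 := by
    have h3 : 6 * (ε ^ 2)⁻¹ * Real.log (2 * n * N / δ) = 6 * Real.log (2 * n * N / δ) / ε ^ 2 := by
      ring
    rw [h3, div_le_iff₀ (by positivity)] at h
    linarith
  have h4 : Real.exp (-(K * ε ^ 2 / 6)) ≤ (2 * n * N / δ)⁻¹ := by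
    rw [← Real.exp_log (inv_pos.2 harg), Real.log_inv]
    exact Real.exp_le_exp.2 (neg_le_neg h2)
  calc 2 * Real.exp (-(K * ε ^ 2 / 6)) ≤ 2 * (2 * n * N / δ)⁻¹ := by gcongr
    _ = δ / (n * N) := by field_simp
    _ ≤ δ / N := by
      gcongr
      nlinarith

theorem psrht_failure_le {n K : ℕ} (hn : 0 < n) {ε δ N : ℝ} (h0 : 0 < ε) (h1 : ε ≤ 1)
    (hδ : 0 < δ) (hδ1 : δ < 1) (hN : 1 ≤ N)
    (h : 2 * (ε ^ 2 - ε ^ 3 / 3)⁻¹ * Real.log (4 * N / δ)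
      * (1 + √(8 * Real.log (4 * n * N / δ))) ^ 2 ≤ K) :
    srhtOrder n * (√2 * Real.exp (-((1 + √(8 * Real.log (4 * n * N / δ))) ^ 2 / 4))) +
      2 * Real.exp (-(K * ε ^ 2 / (2 * (1 + √(8 * Real.log (4 * n * N / δ))) ^ 2))) ≤ δ / N := by
  have hn1 : (1 : ℝ) ≤ n := by exact_mod_cast hn
  have hN0 : 0 < N := by linarith
  have harg : 0 < 4 * N / δ := by positivity
  have harg2 : 1 < 4 * n * N / δ := by
    rw [one_lt_div hδ]
    nlinarith
  have harg1 : 1 < 4 * N / δ := by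
    rw [one_lt_div hδ]
    nlinarith
  have hL0 := Real.log_pos harg2
  have hL1 := Real.log_pos harg1
  set L := Real.log (4 * n * N / δ) with hL
  set μ := (1 + √(8 * L)) ^ 2 with hμ
  have hsq : √(8 * L) ^ 2 = 8 * L := Real.sq_sqrt (by positivity)
  have hμL : 8 * L ≤ μ := by
    rw [hμ]
    nlinarith [Real.sqrt_nonneg (8 * L)]
  have hμ0 : 0 < μ := by positivity
  -- Since `μ ≥ 8 L`, the exponential is at most `(4nN/δ)⁻²`, which beats the number of rows `s ≤
  -- 2n`. The failure budget `δ / N` is split equally between flattening and sampling.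
  have hfirst : srhtOrder n * (√2 * Real.exp (-(μ / 4))) ≤ δ / (2 * N) := by
    have e1 : Real.exp (-(μ / 4)) ≤ (4 * n * N / δ)⁻¹ ^ 2 := by
      have : (4 * n * N / δ)⁻¹ ^ 2 = Real.exp (-(2 * L)) := by
        rw [← Real.exp_log (inv_pos.2 (one_pos.trans harg2)), Real.log_inv, ← hL,
          ← Real.exp_nat_mul]
        congr 1
        push_cast
        ring
      rw [this]
      exact Real.exp_le_exp.2 (by linarith)
    have e2 : √2 ≤ 2 := by
      rw [Real.sqrt_le_iff]
      norm_num
    have e3 : (srhtOrder n : ℝ) ≤ 2 * n := by exact_mod_cast srhtOrder_le hn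
    calc srhtOrder n * (√2 * Real.exp (-(μ / 4))) ≤ 2 * n * (2 * (4 * n * N / δ)⁻¹ ^ 2) := by
          gcongr
      _ = δ / (4 * N) * (δ / (n * N)) := by
          field_simp
          ring
      _ ≤ δ / (4 * N) * 1 := by
          gcongr
          rw [div_le_one (by positivity)]
          nlinarith
      _ ≤ δ / (2 * N) := by
          rw [mul_one]
          gcongr
          norm_num
  have hsecond : 2 * Real.exp (-(K * ε ^ 2 / (2 * μ))) ≤ δ / (2 * N) := by
    have hε : 0 < ε ^ 2 - ε ^ 3 / 3 := by
      have : ε ^ 3 = ε ^ 2 * ε := by ring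
      nlinarith [pow_pos h0 2]
    have e1 : 2 * Real.log (4 * N / δ) * μ ≤ K * (ε ^ 2 - ε ^ 3 / 3) := by
      have e2 : 2 * (ε ^ 2 - ε ^ 3 / 3)⁻¹ * Real.log (4 * N / δ) * μ =
          2 * Real.log (4 * N / δ) * μ / (ε ^ 2 - ε ^ 3 / 3) := by ring
      rwa [e2, div_le_iff₀ hε] at h
    have e3 : (K : ℝ) * (ε ^ 2 - ε ^ 3 / 3) ≤ K * ε ^ 2 := by
      gcongr
      have := pow_pos h0 3
      linarith
    have e4 : Real.log (4 * N / δ) ≤ K * ε ^ 2 / (2 * μ) := by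
      rw [le_div_iff₀ (by positivity)]
      linarith
    calc 2 * Real.exp (-(K * ε ^ 2 / (2 * μ))) ≤ 2 * (4 * N / δ)⁻¹ := by
          rw [← Real.exp_log (inv_pos.2 harg), Real.log_inv]
          gcongr
      _ = δ / (2 * N) := by
          field_simp
          norm_num
  have : δ / N = δ / (2 * N) + δ / (2 * N) := by
    field_simp
    norm_num
  linarith

end FrobPrecond

theorem mainTheorem9 {Ξ : Type*} {n m : ℕ} (hn : 0 < n)
    (A : Ξ → Matrix (Fin n) (Fin n) ℝ) (hA : ∀ ξ, FrobPrecond.IsPositiveDefinite (A ξ))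
    (pts : Fin m → Ξ) (κbar : ℝ) (ξ : Ξ) (Y : Set (Matrix (Fin n) (Fin n) ℝ))
    (hY : Y = FrobPrecond.conePlus (fun i => (A (pts i))⁻¹) ∨
      Y = FrobPrecond.coneKappa (fun i => (A (pts i))⁻¹) κbar) :
    -- the exact Frobenius projection
    (∀ P, FrobPrecond.IsFrobProjection Y (A ξ) P →
      (1 - FrobPrecond.lowestSingularValue (P * A ξ)) ^ 2
          ≤ FrobPrecond.frobNorm (1 - P * A ξ) ^ 2 ∧
      FrobPrecond.frobNorm (1 - P * A ξ) ^ 2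
          ≤ n * (1 - FrobPrecond.lowestSingularValue (P * A ξ) ^ 2) ∧
      0 ≤ FrobPrecond.lowestSingularValue (P * A ξ) ∧
      FrobPrecond.lowestSingularValue (P * A ξ) ≤ 1 ∧
      (P * A ξ = 1 ↔ FrobPrecond.lowestSingularValue (P * A ξ) = 1) ∧
      FrobPrecond.condNumber (P * A ξ) ≤
        ENNReal.ofReal (√(n - (n - 1) * FrobPrecond.lowestSingularValue (P * A ξ) ^ 2))
          / ENNReal.ofReal (FrobPrecond.lowestSingularValue (P * A ξ))) ∧
    -- the projection with respect to the random Frobenius semi-norm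
    (∀ (K : ℕ) (ε δ C : ℝ), 0 < ε → ε ≤ 1 → 0 < δ → 1 < C → ε * (C + 1) / (C - 1) < 1 →
      (6 * (ε ^ 2)⁻¹ * Real.log (2 * n * (9 * C / ε) ^ (m + 1) / δ) ≤ K →
        ENNReal.ofReal (1 - δ) ≤ (FrobPrecond.rademacherLaw n K).toOuterMeasure
          {V | ∀ P, FrobPrecond.IsSemiFrobProjection Y (A ξ) V P →
            FrobPrecond.SemiNormBounds (ε * (C + 1) / (C - 1)) V (P * A ξ)}) ∧
      (∀ (hK : K ≤ FrobPrecond.srhtOrder n)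
        (H : Matrix (Fin (FrobPrecond.srhtOrder n)) (Fin (FrobPrecond.srhtOrder n)) ℝ),
        H.IsHadamard →
        2 * (ε ^ 2 - ε ^ 3 / 3)⁻¹ * Real.log (4 * (9 * C / ε) ^ (m + 1) / δ)
            * (1 + √(8 * Real.log (4 * n * (9 * C / ε) ^ (m + 1) / δ))) ^ 2 ≤ K →
        ENNReal.ofReal (1 - δ) ≤ (FrobPrecond.psrhtLaw n K hK H).toOuterMeasure
          {V | ∀ P, FrobPrecond.IsSemiFrobProjection Y (A ξ) V P →
            FrobPrecond.SemiNormBounds (ε * (C + 1) / (C - 1)) V (P * A ξ)})) := by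
  have hcone : ∀ Q ∈ Y, ∀ t : ℝ, 0 ≤ t → t • Q ∈ Y := by
    rcases hY with rfl | rfl
    · exact fun Q hQ t ht => FrobPrecond.smul_mem_conePlus hQ ht
    · exact fun Q hQ t ht => FrobPrecond.smul_mem_coneKappa hQ ht
  have hspan : Y ⊆ Submodule.span ℝ (Set.range fun i => (A (pts i))⁻¹) := by
    rcases hY with rfl | rfl
    · exact FrobPrecond.conePlus_subset_span _
    · exact FrobPrecond.coneKappa_subset_span _ _
  refine ⟨fun P hP => FrobPrecond.frobProjection_bounds hn hcone hP, ?_⟩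
  intro K ε δ C h0 h1 hδ hC hε'
  have hn1 : (1 : ℝ) ≤ n := by exact_mod_cast hn
  have hN : (1 : ℝ) ≤ (9 * C / ε) ^ (m + 1) := by
    refine one_le_pow₀ ?_
    rw [le_div_iff₀ h0]
    linarith
  have hN0 : 0 < (9 * C / ε) ^ (m + 1) := one_pos.trans_le hN
  -- For `δ ≥ 1` nothing is claimed; for `δ < 1` the logarithms are positive, which forces `K > 0`.
  rcases le_or_gt 1 δ with hδ1 | hδ1
  · have : ENNReal.ofReal (1 - δ) = 0 := ENNReal.ofReal_of_nonpos (by linarith)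
    rw [this]
    exact ⟨fun _ => zero_le, fun _ _ _ _ => zero_le⟩
  refine ⟨fun hK => ?_, fun hKs H hH hK => ?_⟩
  · have hK0 : 0 < K := by
      have hlog : 0 < Real.log (2 * n * (9 * C / ε) ^ (m + 1) / δ) := by
        refine Real.log_pos ?_
        rw [one_lt_div hδ]
        nlinarith
      have : (0 : ℝ) < K := lt_of_lt_of_le (by positivity) hK
      exact_mod_cast this
    refine FrobPrecond.le_prob_semiNormBounds hn FrobPrecond.rademacherMatrix
      (FrobPrecond.frobNorm_rademacherMatrix_sq hK0) h0 h1 hC hδ.le hε' (fun X hX => ?_)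
      hcone hspan (A ξ)
    refine (FrobPrecond.card_rademacher_bad_le hK0 h0 h1 hX).trans ?_
    gcongr
    exact FrobPrecond.rademacher_failure_le hn h0 hδ hN0 hK
  · have hK0 : 0 < K := by
      have hlog : 0 < Real.log (4 * (9 * C / ε) ^ (m + 1) / δ) := by
        refine Real.log_pos ?_
        rw [one_lt_div hδ]
        nlinarith
      have hε : 0 < ε ^ 2 - ε ^ 3 / 3 := by
        have : ε ^ 3 = ε ^ 2 * ε := by ring
        nlinarith [pow_pos h0 2]
      have : (0 : ℝ) < K := lt_of_lt_of_le (by positivity) hK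
      exact_mod_cast this
    have : Nonempty (Fin K ↪ Fin (FrobPrecond.srhtOrder n)) := ⟨Fin.castLEEmb hKs⟩
    refine FrobPrecond.le_prob_semiNormBounds hn (FrobPrecond.psrhtMatrix H)
      (FrobPrecond.frobNorm_psrhtMatrix_sq hK0 hH) h0 h1 hC hδ.le hε' (fun X hX => ?_)
      hcone hspan (A ξ)
    refine (FrobPrecond.card_psrht_bad_le hn hK0 hKs hH hX
      (μ := (1 + √(8 * Real.log (4 * n * (9 * C / ε) ^ (m + 1) / δ))) ^ 2)
      (by positivity) h0 h1).trans ?_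
    gcongr
    exact FrobPrecond.psrht_failure_le hn h0 h1 hδ hδ1 hN hK
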